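/- nother choice only relabels the operations, so the multisets do not change./ **Theorem (Finite $N$ master loop equation).** nother choice only relabels the operations, so the multisets do not change./ nother choice only relabels the operations, so the multisets do not change./ *Lattice and loops.* Let $d\ge 2$ and let $E$ be the set of directed nearest neighbour edges of $\mathbb{Z}^d$; an edge is positively oriented if its ending point is lexicographically greater than its beginning point, and $e^{-1}$ denotes the reversal of $e$. A closed path is a finite (possibly empty) sequence of edges $e_1\cdots e_n$ in which each edge ends where the next one begins, cyclically; its inverse is $e_n^{-1}\cdots e_1^{-1}$. A cycle is a class of closed paths up to cyclic permutation. A backtrack is a pair of cyclically consecutive edges $e,e^{-1}$. A loop is a cycle without backtracks (the empty one is the null loop), and for a cycle $c$ its core $[c]$ is the unique loop obtained from $c$ by erasing backtracks successively. A plaquette is a nonbacktracking closed path of length four; $e_1e_2e_3e_4$ is positively oriented if the beginning point of $e_1$ is lexicographically the smallest of its vertices and the ending point of $e_1$ the second smallest. $\mathcal{P}^+(e)$ is the set of positively oriented plaquettes containing $e$ or $e^{-1}$. Fix for each loop a first edge, by an arbitrary rule; the location $k$ then refers to its $k$-th edge. nother choice only relabels the operations, so the multisets do not change./ nother choice only relabels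 the operations, so the multisets do not change./ A loop sequence $s$ is a finite sequence of loops, two sequences being identified if they differ only by insertion and deletion of null loops; its minimal representation $(l_1,\dots,l_n)$ is the one without null loops, and $|s|=|l_1|+\cdots+|l_n|$, where $|l|$ is the number of edges of $l$. nother choice only relabels the operations, so the multisets do not change./ nother choice only relabels the operations, so the multisets do not change./ *Operations.* Below, $a,b,c,d$ are paths, and a loop is written as a word up to cyclic permutation. nother choice only relabels the operations, so the multisets do not change./ - Mergers of $l$ at location $x$ and $l'$ at location $y$: if $l=aeb$ and $l'=ced$ (with $e$ at $x$ and at $y$), the positive merger is $[aedceb]$ and the negative one is $[ac^{-1}d^{-1}b]$; if $l=aeb$, $l'=ce^{-1}d$, the positive merger is $[aec^{-1}d^{-1}eb]$ and the negative one is $[adcb]$. nother choice only relabels the operations, so the multisets do not change./ - A positive/negative deformation of $l$ at location $x$ with edge $e$ is the positive/negative merger of $l$ at $x$ with a plaquette $p\in\mathcal{P}^+(e)$ at the unique location of $e$ or $e^{-1}$ in $p$. nother choice only relabels the operations, so the multisets do not change./ - Splittings of $l$ at distinct locations $x,y$: if $l=aebec$ (with $e$ at $x$ and at $y$), the positive splitting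 is the pair $[aec],[be]$; if $l=aebe^{-1}c$, the negative splitting is the pair $[ac],[b]$. nother choice only relabels the operations, so the multisets do not change./ - Twistings of $l$ at distinct locations $x,y$: if $l=aebec$, the negative twisting is $[ab^{-1}c]$; if $l=aebe^{-1}c$, the positive twisting is $[aeb^{-1}e^{-1}c]$. nother choice only relabels the operations, so the multisets do not change./ nother choice only relabels the operations, so the multisets do not change./ For a loop sequence $s$ with minimal representation $(l_1,\dots,l_n)$, let $\mathbb{T}^\pm(s)$, $\mathbb{S}^\pm(s)$ and $\mathbb{D}^\pm(s)$ be the collections of loop sequences obtained by replacing one component $l_k$ by a positive/negative twisting, by the (ordered) pair of loops of a positive/negative splitting, or by a positive/negative deformation of it, and $\mathbb{M}^\pm(s)$ the collection obtained by replacing some $l_k$ by its positive/negative merger with some $l_r$, $r\neq k$, and removing $l_r$. These collections are counted with multiplicity: every admissible choice of the component $k$ (of the ordered pair $(k,r)$ for mergers), of the location $x$ or the ordered pair of locations $(x,y)$, and of the plaquette $p$ for deformations, contributes one element. nother choice only relabels the operations, so the multisets do not change./ nother choice only relabels the operations, so the multisets do not change./ *Gauge theory.* Let $\Lambda\subseteq\mathbb{Z}^d$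 be finite and nonempty, $N\ge 2$ an integer and $\beta$ a real number. Let $E_\Lambda^+$ be the set of positively oriented edges with both end points in $\Lambda$, and $\mathcal{P}^+_\Lambda$ the set of positively oriented plaquettes with all vertices in $\Lambda$. For $Q=(Q_e)_{e\in E^+_\Lambda}\in SO(N)^{E_\Lambda^+}$ put $Q_{e^{-1}}:=Q_e^{-1}$, and $Q_p:=Q_{e_1}Q_{e_2}Q_{e_3}Q_{e_4}$ for $p=e_1e_2e_3e_4$. Let $\langle\cdot\rangle$ denote expectation under the probability measure nother choice only relabels the operations, so the multisets do not change./ $$d\mu_{\Lambda,N,\beta}(Q)=Z_{\Lambda,N,\beta}^{-1}\exp\Bigl(N\beta\sum_{p\in\mathcal{P}^+_\Lambda}\operatorname{Tr}(Q_p)\Bigr)\prod_{e\in E^+_\Lambda}d\sigma_N(Q_e),$$ nother choice only relabels the operations, so the multisets do not change./ where $\sigma_N$ is the normalized Haar measure on $SO(N)$ and $Z_{\Lambda,N,\beta}$ is the normalizing constant. For a loop $l=e_1\cdots e_m$ in $\Lambda$ let $W_l:=\operatorname{Tr}(Q_{e_1}\cdots Q_{e_m})$, and for a loop sequence $s$ with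 minimal representation $(l_1,\dots,l_n)$ whose loops lie in $\Lambda$ let nother choice only relabels the operations, so the multisets do not change./ $$\phi(s):=\frac{\langle W_{l_1}W_{l_2}\cdots W_{l_n}\rangle}{N^n}$$ nother choice only relabels the operations, so the multisets do not change./ (so $\phi=1$ for the null loop sequence). nother choice only relabels the operations, so the multisets do not change./ nother choice only relabels the operations, so the multisets do not change./ *Claim.* Let $s$ be a non-null loop sequence with minimal representation $(l_1,\dots,l_n)$ such that all points of $\mathbb{Z}^d$ at lattice distance $\le 1$ from a vertex of some $l_i$ belong to $\Lambda$. Then nother choice only relabels the operations, so the multisets do not change./ $$\begin{aligned}(N-1)|s|\phi(s)=&\sum_{s'\in\mathbb{T}^-(s)}\phi(s')-\sum_{s'\in\mathbb{T}^+(s)}\phi(s')+N\sum_{s'\in\mathbb{S}^-(s)}\phi(s')-N\sum_{s'\in\mathbb{S}^+(s)}\phi(s')\\&+\frac1N\sum_{s'\in\mathbb{M}^-(s)}\phi(s')-\frac1N\sum_{s'\in\mathbb{M}^+(s)}\phi(s')+N\beta\sum_{s'\in\mathbb{D}^-(s)}\phi(s')-N\beta\sum_{s'\in\mathbb{D}^+(s)}\phi(s').\end{aligned}$$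 nother choice only relabels the operations, so the multisets do not change./ -/

import Mathlib

open MeasureTheory

namespace LatticeGauge

/-! ### The lattice, paths and cycles -/

/-- A directed nearest neighbour edge of `ℤ^d`, with beginning point `src` and ending point `tgt`. -/
@[ext] structure Edge (d : ℕ) where
  src : Fin d → ℤ
  tgt : Fin d → ℤ
  adj : ∑ i, |tgt i - src i| = 1

/-- The same edge with the opposite direction. -/
instance {d : ℕ} : Inv (Edge d) :=
  ⟨fun e => ⟨e.tgt, e.src, by simpa only [abs_sub_comm] using e.adj⟩⟩

theorem Edge.inv_inv {d : ℕ} (e : Edge d) : e⁻¹⁻¹ = e := rfl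

/-- The ending point is lexicographically greater than the beginning point. -/
def Edge.IsPos {d : ℕ} (e : Edge d) : Prop := toLex e.src < toLex e.tgt

/-- The inverse `e_n⁻¹ ⋯ e_1⁻¹` of the path `e_1 ⋯ e_n`. -/
def pathInv {d : ℕ} (ρ : List (Edge d)) : List (Edge d) := (ρ.map (·⁻¹)).reverse

/-- `c`, a cyclic word of edges `e_1 ⋯ e_n`, is a cycle of closed paths:
`v(e_i) = u(e_{i+1})` for all `i`, cyclically.  A closed path is a list `ρ` of edges such that
`IsClosed (ρ : Cycle (Edge d))`; the type `Cycle` is lists up to cyclic permutation. -/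
def IsClosed {d : ℕ} (c : Cycle (Edge d)) : Prop := c.Chain fun e f => e.tgt = f.src

/-- `c'` is obtained from `c` by erasing one backtrack, that is, two cyclically consecutive
edges `e, e⁻¹`. -/
def Erase {d : ℕ} (c c' : Cycle (Edge d)) : Prop :=
  ∃ (e : Edge d) (ρ : List (Edge d)), c = ↑(e :: e⁻¹ :: ρ) ∧ c' = ↑ρ

/-- There is no backtrack. -/
def IsNonbacktracking {d : ℕ} (c : Cycle (Edge d)) : Prop := ∀ c', ¬ Erase c c'

theorem exists_core {d : ℕ} (c : Cycle (Edge d)) :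
    ∃ c', Relation.ReflTransGen Erase c c' ∧ IsNonbacktracking c' := by
  induction h : c.length using Nat.strong_induction_on generalizing c with
  | _ n ih =>
    by_cases hc : IsNonbacktracking c
    · exact ⟨c, .refl, hc⟩
    · simp only [IsNonbacktracking, not_forall, not_not] at hc
      obtain ⟨c₁, h₁⟩ := hc
      have hlt : c₁.length < n := by
        obtain ⟨e, ρ, rfl, rfl⟩ := h₁
        simp only [Cycle.length_coe, List.length_cons] at h ⊢
        omega
      obtain ⟨c', h₂, h₃⟩ := ih _ hlt c₁ rfl
      exact ⟨c', .head h₁ h₂, h₃⟩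

/-- The nonbacktracking core `[c]`: the cycle without backtracks that results from erasing
backtracks successively.  It does not depend on the choices, see `eq_core`. -/
noncomputable def core {d : ℕ} (c : Cycle (Edge d)) : Cycle (Edge d) :=
  Classical.choose (exists_core c)

theorem core_spec {d : ℕ} (c : Cycle (Edge d)) :
    Relation.ReflTransGen Erase c (core c) ∧ IsNonbacktracking (core c) :=
  Classical.choose_spec (exists_core c)

theorem erase_diamond {d : ℕ} {c c₁ c₂ : Cycle (Edge d)} (h₁ : Erase c c₁) (h₂ : Erase c c₂) :
    c₁ = c₂ ∨ ∃ c₃, Erase c₁ c₃ ∧ Erase c₂ c₃ := by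
  obtain ⟨e, a, rfl, rfl⟩ := h₁
  obtain ⟨f, b, h, rfl⟩ := h₂
  rw [Cycle.coe_eq_coe] at h
  obtain ⟨n, hn, h⟩ := List.isRotated_iff_mod.1 h
  rw [List.rotate_eq_drop_append_take hn] at h
  match n, hn, h with
  | 0, _, h =>
    simp only [List.drop_zero, List.take_zero, List.append_nil, List.cons.injEq] at h
    exact Or.inl (by rw [h.2.2])
  | 1, _, h =>
    simp only [List.drop_succ_cons, List.drop_zero, List.take_succ_cons, List.take_zero,
      List.cons_append, List.cons.injEq] at h
    obtain ⟨rfl, h⟩ := h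
    rw [Edge.inv_inv] at h
    left
    cases a with
    | nil =>
      simp only [List.nil_append, List.cons.injEq] at h
      rw [← h.2]
    | cons g a =>
      simp only [List.cons_append, List.cons.injEq] at h
      obtain ⟨rfl, rfl⟩ := h
      exact Cycle.coe_cons_eq_coe_append a g
  | m + 2, _, h =>
    simp only [List.drop_succ_cons, List.take_succ_cons] at h
    obtain ⟨u, v, hu, hv⟩ : ∃ u v, a.take m = u ∧ a.drop m = v := ⟨_, _, rfl, rfl⟩
    rw [← List.take_append_drop m a]
    rw [hu, hv] at h ⊢
    match v, h with
    | [], h =>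
      simp only [List.nil_append, List.cons.injEq] at h
      left
      rw [List.append_nil, h.2.2]
    | [g], h =>
      simp only [List.cons_append, List.nil_append, List.cons.injEq] at h
      obtain ⟨rfl, rfl, rfl⟩ := h
      left
      rw [Edge.inv_inv]
      exact (Cycle.coe_cons_eq_coe_append u g).symm
    | g :: g' :: v, h =>
      simp only [List.cons_append, List.cons.injEq] at h
      obtain ⟨rfl, rfl, rfl⟩ := h
      right
      refine ⟨↑(v ++ u), ⟨g, v ++ u, ?_, rfl⟩, ⟨e, u ++ v, ?_, ?_⟩⟩
      · rw [Cycle.coe_eq_coe]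
        exact List.isRotated_append (l := u) (l' := g :: g⁻¹ :: v)
      · rw [Cycle.coe_eq_coe]
        exact (List.isRotated_append (l := v) (l' := e :: e⁻¹ :: u)).symm.symm
      · rw [Cycle.coe_eq_coe]
        exact List.isRotated_append

/-- Uniqueness of the nonbacktracking core. -/
theorem eq_core {d : ℕ} {c c' : Cycle (Edge d)} (h : Relation.ReflTransGen Erase c c')
    (h' : IsNonbacktracking c') : c' = core c := by
  obtain ⟨c₁, h₁, h₂⟩ := Relation.church_rosser (r := Erase) (fun a b c hb hc => by
    rcases erase_diamond hb hc with rfl | ⟨x, hx, hx'⟩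
    · exact ⟨b, .refl, .refl⟩
    · exact ⟨x, .single hx, .single hx'⟩) h (core_spec c).1
  have key : ∀ {x y : Cycle (Edge d)}, IsNonbacktracking x →
      Relation.ReflTransGen Erase x y → x = y := fun hx hxy => by
    rcases hxy.cases_head with h | ⟨z, hz, _⟩
    · exact h
    · exact absurd hz (hx z)
  rw [key h' h₁, key (core_spec c).2 h₂]

/-- The list of edges is a path from `u` to `v`. -/
def IsPathFromTo {d : ℕ} (u v : Fin d → ℤ) : List (Edge d) → Prop
  | [] => u = v
  | e :: ρ => e.src = u ∧ IsPathFromTo e.tgt v ρ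

theorem isPathFromTo_append {d : ℕ} {u v : Fin d → ℤ} {ρ ρ' : List (Edge d)} :
    IsPathFromTo u v (ρ ++ ρ') ↔ ∃ w, IsPathFromTo u w ρ ∧ IsPathFromTo w v ρ' := by
  induction ρ generalizing u with
  | nil => simp [IsPathFromTo]
  | cons e ρ ih => simp [IsPathFromTo, ih, and_assoc]

theorem IsPathFromTo.append {d : ℕ} {u v w : Fin d → ℤ} {ρ ρ' : List (Edge d)}
    (h : IsPathFromTo u w ρ) (h' : IsPathFromTo w v ρ') : IsPathFromTo u v (ρ ++ ρ') :=
  isPathFromTo_append.2 ⟨w, h, h'⟩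

theorem IsPathFromTo.inv {d : ℕ} {u v : Fin d → ℤ} {ρ : List (Edge d)}
    (h : IsPathFromTo u v ρ) : IsPathFromTo v u (pathInv ρ) := by
  induction ρ generalizing u with
  | nil => exact Eq.symm h
  | cons e ρ ih =>
    obtain ⟨rfl, h⟩ := h
    simp only [pathInv, List.map_cons, List.reverse_cons]
    exact (ih h).append ⟨rfl, rfl⟩

theorem isClosed_cons {d : ℕ} {e : Edge d} {ρ : List (Edge d)} :
    IsClosed (↑(e :: ρ) : Cycle (Edge d)) ↔ IsPathFromTo e.tgt e.src ρ := by
  have key : ∀ (e f : Edge d), List.IsChain (fun e f : Edge d => e.tgt = f.src) (e :: (ρ ++ [f])) ↔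
      IsPathFromTo e.tgt f.src ρ := by
    induction ρ with
    | nil => intro e f; simp [IsPathFromTo]
    | cons g ρ ih =>
      intro e f
      rw [List.cons_append, List.isChain_cons_cons, ih, IsPathFromTo, eq_comm (a := e.tgt)]
  rw [IsClosed, Cycle.chain_coe_cons, key]

theorem IsPathFromTo.isClosed {d : ℕ} {u : Fin d → ℤ} {ρ : List (Edge d)}
    (h : IsPathFromTo u u ρ) : IsClosed (ρ : Cycle (Edge d)) := by
  cases ρ with
  | nil => exact Cycle.Chain.nil _
  | cons e ρ =>
    obtain ⟨rfl, h⟩ := h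
    exact isClosed_cons.2 h

theorem IsClosed.core {d : ℕ} {c : Cycle (Edge d)} (h : IsClosed c) : IsClosed (core c) := by
  have key : ∀ c', Relation.ReflTransGen Erase c c' → IsClosed c' := by
    intro c' hc
    induction hc with
    | refl => exact h
    | tail _ h₂ ih =>
      obtain ⟨e, ρ, rfl, rfl⟩ := h₂
      obtain ⟨-, h'⟩ := isClosed_cons.1 ih
      exact IsPathFromTo.isClosed h'
  exact key _ (core_spec c).1

/-! ### Loops and loop sequences -/

/-- A loop: a nonbacktracking cycle. -/
def Loop (d : ℕ) : Type := {c : Cycle (Edge d) // IsClosed c ∧ IsNonbacktracking c}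

/-- The null loop. -/
def Loop.null (d : ℕ) : Loop d :=
  ⟨Cycle.nil, Cycle.Chain.nil _, by
    rintro c' ⟨e, ρ, h, -⟩
    exact absurd ((Cycle.coe_eq_nil _).1 h.symm) (by simp)⟩

/-- The number of edges. -/
def Loop.length {d : ℕ} (l : Loop d) : ℕ := l.1.length

/-- The vertices visited by a loop. -/
def Loop.vertices {d : ℕ} (l : Loop d) : Set (Fin d → ℤ) :=
  {v | ∃ e ∈ l.1, v = e.src ∨ v = e.tgt}

/-- The closed path obtained from a loop by declaring one of its edges, selected by an arbitrary
rule, to be the first one.  The locations in `l` are the indices of this list. -/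
noncomputable def Loop.path {d : ℕ} (l : Loop d) : List (Edge d) := Quotient.out l.1

theorem Loop.coe_path {d : ℕ} (l : Loop d) : (l.path : Cycle (Edge d)) = l.1 := Quotient.out_eq _

/-- The loop `[ρ]`, for a closed path `ρ`. -/
noncomputable def coreLoop {d : ℕ} (ρ : List (Edge d)) (h : IsClosed (ρ : Cycle (Edge d))) :
    Loop d :=
  ⟨core ρ, h.core, (core_spec _).2⟩

open scoped Classical in
/-- Delete the null loops from a finite sequence of loops. -/
noncomputable def dropNull {d : ℕ} (L : List (Loop d)) : List (Loop d) :=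
  L.filter (· ≠ Loop.null d)

/-- Two finite sequences of loops are equivalent if they differ only by null loops. -/
instance loopSeqSetoid (d : ℕ) : Setoid (List (Loop d)) where
  r L L' := dropNull L = dropNull L'
  iseqv := ⟨fun _ => rfl, fun h => h.symm, fun h h' => h.trans h'⟩

/-- Loop sequences. -/
def LoopSeq (d : ℕ) : Type := Quotient (loopSeqSetoid d)

/-- The loop sequence represented by `(l_1, …, l_n)`. -/
def LoopSeq.mk {d : ℕ} (L : List (Loop d)) : LoopSeq d := Quotient.mk _ L

/-- The null loop sequence. -/
def LoopSeq.null (d : ℕ) : LoopSeq d := LoopSeq.mk [Loop.null d]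

/-- The minimal representation: the representative without null loops. -/
noncomputable def LoopSeq.minRep {d : ℕ} (s : LoopSeq d) : List (Loop d) :=
  Quotient.lift dropNull (fun _ _ h => h) s

/-- The length `|s|`. -/
noncomputable def LoopSeq.length {d : ℕ} (s : LoopSeq d) : ℕ := (s.minRep.map Loop.length).sum

/-! ### Operations on loops

A closed path is a list `ρ` and a location in it is `x : Fin ρ.length`.  Cyclic words are written
starting from location `x`: if `ρ = a e b` with `e` at location `x`, then the cycle of `ρ` is that
of `e (b a)`, and `b a = arc ρ x x`.  If `ρ = a e b f c` with `e` at `x` and `f` at `y`, then the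
cycle of `ρ` is that of `e b f (c a)`, where `b = arc ρ x y` and `c a = arc ρ y x`.  This also
covers the case that location `y` precedes location `x`. -/

/-- The edges strictly between location `x` and the next visit to location `y`, in cyclic order. -/
def arc {d : ℕ} (ρ : List (Edge d)) (x y : ℕ) : List (Edge d) :=
  if x < y then (ρ.drop (x + 1)).take (y - (x + 1)) else ρ.drop (x + 1) ++ ρ.take y

theorem coe_eq_arc {d : ℕ} (ρ : List (Edge d)) (x : Fin ρ.length) :
    (ρ : Cycle (Edge d)) = ↑(ρ[x] :: arc ρ x x) := by
  rw [Cycle.coe_eq_coe]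
  have h : ρ = ρ.take x ++ (ρ[x] :: ρ.drop (x + 1)) := by
    rw [Fin.getElem_fin, List.getElem_cons_drop, List.take_append_drop]
  have h' : ρ[x] :: arc ρ x x = (ρ[x] :: ρ.drop (x + 1)) ++ ρ.take x := by
    rw [arc, if_neg (lt_irrefl _), List.cons_append]
  rw [h']
  conv_lhs => rw [h]
  exact List.isRotated_append

theorem coe_eq_arc_arc {d : ℕ} (ρ : List (Edge d)) (x y : Fin ρ.length) (h : x ≠ y) :
    (ρ : Cycle (Edge d)) = ↑(ρ[x] :: (arc ρ x y ++ ρ[y] :: arc ρ y x)) := by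
  have aux : ∀ x y : Fin ρ.length, x < y →
      ρ.drop (x + 1) = arc ρ x y ++ ρ[y] :: ρ.drop (y + 1) := by
    intro x y hxy
    have hxy' : (x : ℕ) < y := hxy
    rw [arc, if_pos hxy']
    conv_lhs => rw [← List.take_append_drop (y - (x + 1)) (ρ.drop (x + 1))]
    rw [List.drop_drop, show (x : ℕ) + 1 + (y - (x + 1)) = y by omega]
    simp
  rcases lt_or_gt_of_ne h with hxy | hxy
  · have hn : ¬ (y : ℕ) < x := not_lt.2 (le_of_lt hxy)
    rw [coe_eq_arc ρ x]
    have : arc ρ x x = arc ρ x y ++ ρ[y] :: arc ρ y x := by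
      conv_lhs => rw [arc, if_neg (lt_irrefl _), aux x y hxy]
      rw [arc.eq_1 ρ y x, if_neg hn, List.append_assoc, List.cons_append]
    rw [this]
  · have hn : ¬ (x : ℕ) < y := not_lt.2 (le_of_lt hxy)
    rw [coe_eq_arc ρ y]
    have : arc ρ y y = arc ρ y x ++ ρ[x] :: arc ρ x y := by
      conv_lhs => rw [arc, if_neg (lt_irrefl _), aux y x hxy]
      rw [arc.eq_1 ρ x y, if_neg hn, List.append_assoc, List.cons_append]
    rw [this, Cycle.coe_eq_coe]
    simpa using List.isRotated_append (l := ρ[y] :: arc ρ y x) (l' := ρ[x] :: arc ρ x y)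

theorem isPathFromTo_arc {d : ℕ} {ρ : List (Edge d)} (hρ : IsClosed (ρ : Cycle (Edge d)))
    (x : Fin ρ.length) : IsPathFromTo ρ[x].tgt ρ[x].src (arc ρ x x) := by
  rw [coe_eq_arc ρ x] at hρ
  exact isClosed_cons.1 hρ

theorem isPathFromTo_arc_arc {d : ℕ} {ρ : List (Edge d)} (hρ : IsClosed (ρ : Cycle (Edge d)))
    {x y : Fin ρ.length} (h : x ≠ y) :
    IsPathFromTo ρ[x].tgt ρ[y].src (arc ρ x y) ∧ IsPathFromTo ρ[y].tgt ρ[x].src (arc ρ y x) := by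
  rw [coe_eq_arc_arc ρ x y h] at hρ
  obtain ⟨w, h₁, h₂⟩ := isPathFromTo_append.1 (isClosed_cons.1 hρ)
  obtain ⟨rfl, h₂⟩ := h₂
  exact ⟨h₁, h₂⟩

theorem Loop.isClosed_path {d : ℕ} (l : Loop d) : IsClosed (l.path : Cycle (Edge d)) := by
  rw [l.coe_path]; exact l.2.1

/-- Locations `x ≠ y` of a closed path with the same edge. -/
def SameAt {d : ℕ} (ρ : List (Edge d)) (x y : Fin ρ.length) : Prop := x ≠ y ∧ ρ[y] = ρ[x]

/-- Locations `x ≠ y` of a closed path with mutually inverse edges. -/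
def InvAt {d : ℕ} (ρ : List (Edge d)) (x y : Fin ρ.length) : Prop := x ≠ y ∧ ρ[y] = ρ[x]⁻¹

/-- First component `[a e c]` of the positive splitting of `a e b e c`. -/
noncomputable def Loop.posSplit₁ {d : ℕ} (l : Loop d) (x y : Fin l.path.length)
    (h : SameAt l.path x y) : Loop d :=
  coreLoop (l.path[x] :: arc l.path y x) <| by
    have h₁ := (isPathFromTo_arc_arc l.isClosed_path h.1).2
    rw [h.2] at h₁
    exact isClosed_cons.2 h₁

/-- Second component `[b e]` of the positive splitting of `a e b e c`. -/
noncomputable def Loop.posSplit₂ {d : ℕ} (l : Loop d) (x y : Fin l.path.length)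
    (h : SameAt l.path x y) : Loop d :=
  coreLoop (arc l.path x y ++ [l.path[x]]) <| by
    have h₁ := (isPathFromTo_arc_arc l.isClosed_path h.1).1
    rw [h.2] at h₁
    exact IsPathFromTo.isClosed (h₁.append ⟨rfl, rfl⟩)

/-- First component `[a c]` of the negative splitting of `a e b e⁻¹ c`. -/
noncomputable def Loop.negSplit₁ {d : ℕ} (l : Loop d) (x y : Fin l.path.length)
    (h : InvAt l.path x y) : Loop d :=
  coreLoop (arc l.path y x) <| by
    have h₁ := (isPathFromTo_arc_arc l.isClosed_path h.1).2
    rw [h.2] at h₁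
    exact IsPathFromTo.isClosed h₁

/-- Second component `[b]` of the negative splitting of `a e b e⁻¹ c`. -/
noncomputable def Loop.negSplit₂ {d : ℕ} (l : Loop d) (x y : Fin l.path.length)
    (h : InvAt l.path x y) : Loop d :=
  coreLoop (arc l.path x y) <| by
    have h₁ := (isPathFromTo_arc_arc l.isClosed_path h.1).1
    rw [h.2] at h₁
    exact IsPathFromTo.isClosed h₁

/-- Negative twisting `[a b⁻¹ c]` of `a e b e c`. -/
noncomputable def Loop.negTwist {d : ℕ} (l : Loop d) (x y : Fin l.path.length)
    (h : SameAt l.path x y) : Loop d :=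
  coreLoop (pathInv (arc l.path x y) ++ arc l.path y x) <| by
    obtain ⟨h₁, h₂⟩ := isPathFromTo_arc_arc l.isClosed_path h.1
    rw [h.2] at h₁ h₂
    exact IsPathFromTo.isClosed (h₁.inv.append h₂)

/-- Positive twisting `[a e b⁻¹ e⁻¹ c]` of `a e b e⁻¹ c`. -/
noncomputable def Loop.posTwist {d : ℕ} (l : Loop d) (x y : Fin l.path.length)
    (h : InvAt l.path x y) : Loop d :=
  coreLoop (l.path[x] :: (pathInv (arc l.path x y) ++ l.path[x]⁻¹ :: arc l.path y x)) <| by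
    obtain ⟨h₁, h₂⟩ := isPathFromTo_arc_arc l.isClosed_path h.1
    rw [h.2] at h₁ h₂
    exact isClosed_cons.2 (h₁.inv.append ⟨rfl, h₂⟩)

/-- The edge of `ρ'` at location `y` is the edge of `ρ` at location `x`, or its inverse. -/
def Parallel {d : ℕ} (ρ ρ' : List (Edge d)) (x : Fin ρ.length) (y : Fin ρ'.length) : Prop :=
  ρ'[y] = ρ[x] ∨ ρ'[y] = ρ[x]⁻¹

open scoped Classical in
/-- Positive merger of the closed paths `ρ` and `ρ'` at locations `x` and `y`:
`[a e d c e b]` for `ρ = a e b`, `ρ' = c e d`, and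
`[a e c⁻¹ d⁻¹ e b]` for `ρ = a e b`, `ρ' = c e⁻¹ d`. -/
noncomputable def posMerge {d : ℕ} (ρ ρ' : List (Edge d)) (hρ : IsClosed (ρ : Cycle (Edge d)))
    (hρ' : IsClosed (ρ' : Cycle (Edge d))) (x : Fin ρ.length) (y : Fin ρ'.length)
    (h : Parallel ρ ρ' x y) : Loop d :=
  coreLoop (ρ[x] :: ((if ρ'[y] = ρ[x] then arc ρ' y y else pathInv (arc ρ' y y)) ++
    ρ[x] :: arc ρ x x)) <| by
    have h₁ := isPathFromTo_arc hρ x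
    have h₂ := isPathFromTo_arc hρ' y
    refine isClosed_cons.2 (IsPathFromTo.append (w := ρ[x].src) ?_ ⟨rfl, h₁⟩)
    split_ifs with he
    · rwa [he] at h₂
    · rw [h.resolve_left he] at h₂
      exact h₂.inv

open scoped Classical in
/-- Negative merger of the closed paths `ρ` and `ρ'` at locations `x` and `y`:
`[a c⁻¹ d⁻¹ b]` for `ρ = a e b`, `ρ' = c e d`, and
`[a d c b]` for `ρ = a e b`, `ρ' = c e⁻¹ d`. -/
noncomputable def negMerge {d : ℕ} (ρ ρ' : List (Edge d)) (hρ : IsClosed (ρ : Cycle (Edge d)))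
    (hρ' : IsClosed (ρ' : Cycle (Edge d))) (x : Fin ρ.length) (y : Fin ρ'.length)
    (h : Parallel ρ ρ' x y) : Loop d :=
  coreLoop ((if ρ'[y] = ρ[x] then pathInv (arc ρ' y y) else arc ρ' y y) ++ arc ρ x x) <| by
    have h₁ := isPathFromTo_arc hρ x
    have h₂ := isPathFromTo_arc hρ' y
    refine IsPathFromTo.isClosed (IsPathFromTo.append (w := ρ[x].tgt) ?_ h₁)
    split_ifs with he
    · rw [he] at h₂
      exact h₂.inv
    · rw [h.resolve_left he] at h₂
      exact h₂

/-! ### Plaquettes -/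

/-- A plaquette: a nonbacktracking closed path of length four. -/
def IsPlaquette {d : ℕ} (p : List (Edge d)) : Prop :=
  p.length = 4 ∧ IsClosed (p : Cycle (Edge d)) ∧ IsNonbacktracking (p : Cycle (Edge d))

/-- A positively oriented plaquette `e₁e₂e₃e₄`: `u(e₁)` is lexicographically the smallest of the
four vertices `u(e₁), u(e₂), u(e₃), u(e₄)`, and `v(e₁) = u(e₂)` is the second smallest. -/
def IsPosPlaquette {d : ℕ} (p : List (Edge d)) : Prop :=
  IsPlaquette p ∧ ∃ e₁ e₂ e₃ e₄ : Edge d, p = [e₁, e₂, e₃, e₄] ∧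
    toLex e₁.src < toLex e₂.src ∧ toLex e₂.src < toLex e₃.src ∧ toLex e₂.src < toLex e₄.src

theorem finite_edgesIn {d : ℕ} (Λ : Finset (Fin d → ℤ)) :
    {e : Edge d | e.src ∈ Λ ∧ e.tgt ∈ Λ}.Finite := by
  refine Set.Finite.of_finite_image (f := fun e : Edge d => (e.src, e.tgt))
    ((Λ ×ˢ Λ).finite_toSet.subset ?_) ?_
  · rintro _ ⟨e, he, rfl⟩
    simpa using he
  · intro e _ f _ h
    simp only [Prod.mk.injEq] at h
    exact Edge.ext h.1 h.2

theorem finite_posPlaquettesIn {d : ℕ} (Λ : Finset (Fin d → ℤ)) :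
    {p : List (Edge d) | IsPosPlaquette p ∧ ∀ e ∈ p, e.src ∈ Λ ∧ e.tgt ∈ Λ}.Finite := by
  have := (finite_edgesIn Λ).to_subtype
  refine ((List.finite_length_eq {e : Edge d | e.src ∈ Λ ∧ e.tgt ∈ Λ} 4).image
    (List.map Subtype.val)).subset ?_
  rintro p ⟨hp, h⟩
  refine ⟨p.attach.map fun e => ⟨e.1, h e.1 e.2⟩, ?_, ?_⟩
  · rw [Set.mem_ofPred_eq, List.length_map, List.length_attach, hp.1.1]
  · simp [List.map_map, Function.comp_def]

/-- The set `𝒫⁺_Λ` of positively oriented plaquettes with all vertices in `Λ`. -/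
noncomputable def posPlaquettesIn {d : ℕ} (Λ : Finset (Fin d → ℤ)) : Finset (List (Edge d)) :=
  (finite_posPlaquettesIn Λ).toFinset

theorem finite_posPlaquettesAt {d : ℕ} (e : Edge d) :
    {p : List (Edge d) | IsPosPlaquette p ∧ (e ∈ p ∨ e⁻¹ ∈ p)}.Finite := by
  have bd : ∀ (f : Edge d) (i : Fin d), |f.tgt i - f.src i| ≤ 1 := fun f i =>
    (Finset.single_le_sum (f := fun i => |f.tgt i - f.src i|) (fun _ _ => abs_nonneg _)
      (Finset.mem_univ i)).trans f.adj.le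
  refine (finite_posPlaquettesIn (Finset.Icc (fun i => e.src i - 4) (fun i => e.src i + 4))).subset
    fun p ⟨hp, he⟩ => ⟨hp, ?_⟩
  obtain ⟨⟨-, hc, -⟩, e₁, e₂, e₃, e₄, rfl, -⟩ := hp
  obtain ⟨h₁, h₂, h₃, h₄⟩ := isClosed_cons.1 hc
  have hs : ∃ f ∈ [e₁, e₂, e₃, e₄], e.src = f.src ∨ e.src = f.tgt := by
    rcases he with he | he
    · exact ⟨e, he, Or.inl rfl⟩
    · exact ⟨_, he, Or.inr rfl⟩
  obtain ⟨f, hf, hs⟩ := hs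
  intro g hg
  simp only [Finset.mem_Icc, Pi.le_def, ← forall_and]
  intro i
  have b₁ := abs_le.1 (bd e₁ i)
  have b₂ := abs_le.1 (bd e₂ i)
  have b₃ := abs_le.1 (bd e₃ i)
  have b₄ := abs_le.1 (bd e₄ i)
  have c₁ := congrFun h₁ i
  have c₂ := congrFun h₂ i
  have c₃ := congrFun h₃ i
  have c₄ := congrFun h₄ i
  have hs' : e.src i = f.src i ∨ e.src i = f.tgt i := hs.imp (congrFun · i) (congrFun · i)
  simp only [List.mem_cons, List.not_mem_nil, or_false] at hf hg
  rcases hf with rfl | rfl | rfl | rfl <;> rcases hg with rfl | rfl | rfl | rfl <;> omega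

/-- The set `𝒫⁺(e)` of positively oriented plaquettes that contain `e` or `e⁻¹`. -/
noncomputable def posPlaquettesAt {d : ℕ} (e : Edge d) : Finset (List (Edge d)) :=
  (finite_posPlaquettesAt e).toFinset

theorem isClosed_of_mem_posPlaquettesAt {d : ℕ} {e : Edge d} {p : List (Edge d)}
    (h : p ∈ posPlaquettesAt e) : IsClosed (p : Cycle (Edge d)) :=
  ((finite_posPlaquettesAt e).mem_toFinset.1 h).1.1.2.1

/-! ### Operations on loop sequences

The collections `𝕋^±(s)`, `𝕊^±(s)`, `𝕄^±(s)`, `𝔻^±(s)` are multisets: every operation, that is,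
every admissible choice of component loops, ordered pair of locations and plaquette, counts once. -/

/-- Replace the component `l_k` of the minimal representation by the sequence `L`. -/
noncomputable def LoopSeq.replace {d : ℕ} (s : LoopSeq d) (k : Fin s.minRep.length)
    (L : List (Loop d)) : LoopSeq d :=
  LoopSeq.mk (s.minRep.take k ++ L ++ s.minRep.drop (k + 1))

/-- Replace the component `l_k` of the minimal representation by `l` and remove `l_r`. -/
noncomputable def LoopSeq.replaceRemove {d : ℕ} (s : LoopSeq d) (k r : Fin s.minRep.length)
    (l : Loop d) : LoopSeq d :=
  LoopSeq.mk ((s.minRep.set k l).eraseIdx r)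

open scoped Classical in
/-- `𝕋⁺(s)` -/
noncomputable def LoopSeq.posTwistings {d : ℕ} (s : LoopSeq d) : Multiset (LoopSeq d) :=
  ∑ k : Fin s.minRep.length, ∑ x, ∑ y,
    if h : InvAt s.minRep[k].path x y then {s.replace k [s.minRep[k].posTwist x y h]} else 0

open scoped Classical in
/-- `𝕋⁻(s)` -/
noncomputable def LoopSeq.negTwistings {d : ℕ} (s : LoopSeq d) : Multiset (LoopSeq d) :=
  ∑ k : Fin s.minRep.length, ∑ x, ∑ y,
    if h : SameAt s.minRep[k].path x y then {s.replace k [s.minRep[k].negTwist x y h]} else 0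

open scoped Classical in
/-- `𝕊⁺(s)` -/
noncomputable def LoopSeq.posSplittings {d : ℕ} (s : LoopSeq d) : Multiset (LoopSeq d) :=
  ∑ k : Fin s.minRep.length, ∑ x, ∑ y,
    if h : SameAt s.minRep[k].path x y then
      {s.replace k [s.minRep[k].posSplit₁ x y h, s.minRep[k].posSplit₂ x y h]} else 0

open scoped Classical in
/-- `𝕊⁻(s)` -/
noncomputable def LoopSeq.negSplittings {d : ℕ} (s : LoopSeq d) : Multiset (LoopSeq d) :=
  ∑ k : Fin s.minRep.length, ∑ x, ∑ y,
    if h : InvAt s.minRep[k].path x y then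
      {s.replace k [s.minRep[k].negSplit₁ x y h, s.minRep[k].negSplit₂ x y h]} else 0

open scoped Classical in
/-- `𝕄⁺(s)` -/
noncomputable def LoopSeq.posMergers {d : ℕ} (s : LoopSeq d) : Multiset (LoopSeq d) :=
  ∑ k : Fin s.minRep.length, ∑ r : Fin s.minRep.length, ∑ x, ∑ y,
    if h : k ≠ r ∧ Parallel s.minRep[k].path s.minRep[r].path x y then
      {s.replaceRemove k r (posMerge s.minRep[k].path s.minRep[r].path
        s.minRep[k].isClosed_path s.minRep[r].isClosed_path x y h.2)} else 0

open scoped Classical in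
/-- `𝕄⁻(s)` -/
noncomputable def LoopSeq.negMergers {d : ℕ} (s : LoopSeq d) : Multiset (LoopSeq d) :=
  ∑ k : Fin s.minRep.length, ∑ r : Fin s.minRep.length, ∑ x, ∑ y,
    if h : k ≠ r ∧ Parallel s.minRep[k].path s.minRep[r].path x y then
      {s.replaceRemove k r (negMerge s.minRep[k].path s.minRep[r].path
        s.minRep[k].isClosed_path s.minRep[r].isClosed_path x y h.2)} else 0

open scoped Classical in
/-- `𝔻⁺(s)`: mergers of a component loop, at a location `x` with edge `e`, with a plaquette
`p ∈ 𝒫⁺(e)` at the location `y` of `e` or `e⁻¹` in `p` (there is exactly one such `y`). -/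
noncomputable def LoopSeq.posDeformations {d : ℕ} (s : LoopSeq d) : Multiset (LoopSeq d) :=
  ∑ k : Fin s.minRep.length, ∑ x : Fin s.minRep[k].path.length,
    ∑ p ∈ (posPlaquettesAt s.minRep[k].path[x]).attach, ∑ y,
      if h : Parallel s.minRep[k].path p.1 x y then
        {s.replace k [posMerge s.minRep[k].path p.1 s.minRep[k].isClosed_path
          (isClosed_of_mem_posPlaquettesAt p.2) x y h]} else 0

open scoped Classical in
/-- `𝔻⁻(s)` -/
noncomputable def LoopSeq.negDeformations {d : ℕ} (s : LoopSeq d) : Multiset (LoopSeq d) :=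
  ∑ k : Fin s.minRep.length, ∑ x : Fin s.minRep[k].path.length,
    ∑ p ∈ (posPlaquettesAt s.minRep[k].path[x]).attach, ∑ y,
      if h : Parallel s.minRep[k].path p.1 x y then
        {s.replace k [negMerge s.minRep[k].path p.1 s.minRep[k].isClosed_path
          (isClosed_of_mem_posPlaquettesAt p.2) x y h]} else 0

/-! ### The group `SO(N)` and lattice gauge theory -/

/-- The group of `N × N` real orthogonal matrices of determinant one. -/
abbrev SO (N : ℕ) : Type := Matrix.specialOrthogonalGroup (Fin N) ℝ

instance (N : ℕ) : IsTopologicalGroup (SO N) where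
  continuous_mul := by fun_prop
  continuous_inv := by
    refine Continuous.subtype_mk (f := fun A : SO N => star (A : Matrix (Fin N) (Fin N) ℝ)) ?_ _
    exact continuous_subtype_val.star

instance (N : ℕ) : MeasurableSpace (SO N) := borel _

instance (N : ℕ) : BorelSpace (SO N) := ⟨rfl⟩

instance (N : ℕ) : CompactSpace (SO N) := by
  suffices h : IsCompact ((Matrix.specialOrthogonalGroup (Fin N) ℝ :
      Submonoid (Matrix (Fin N) (Fin N) ℝ)) : Set (Matrix (Fin N) (Fin N) ℝ)) from
    isCompact_iff_compactSpace.1 h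
  refine IsCompact.of_isClosed_subset (s := Set.univ.pi fun _ => Set.univ.pi fun _ => Set.Icc (-1) 1)
    (isCompact_univ_pi fun _ => isCompact_univ_pi fun _ => isCompact_Icc) ?_ ?_
  · have : ((Matrix.specialOrthogonalGroup (Fin N) ℝ : Submonoid (Matrix (Fin N) (Fin N) ℝ)) :
        Set (Matrix (Fin N) (Fin N) ℝ)) = {A | A * star A = 1} ∩ {A | A.det = 1} := by
      ext A
      simp only [SetLike.mem_coe, Matrix.mem_specialOrthogonalGroup_iff,
        Matrix.mem_orthogonalGroup_iff, Set.mem_inter_iff, Set.mem_ofPred_eq,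
        Matrix.star_eq_conjTranspose, Matrix.conjTranspose_eq_transpose_of_trivial]
    rw [this]
    exact (isClosed_eq (continuous_id.mul continuous_id.star) continuous_const).inter
      (isClosed_eq continuous_id.matrix_det continuous_const)
  · intro A hA i _ j _
    have := entry_norm_bound_of_unitary (Matrix.mem_specialOrthogonalGroup_iff.1 hA).1 i j
    exact abs_le.1 this

/-- The Haar measure of `SO(N)`, with total mass one. -/
noncomputable def haarSO (N : ℕ) : Measure (SO N) := Measure.haarMeasure ⊤

/-- The set `E⁺_Λ` of positively oriented edges with both end points in `Λ`. -/
abbrev PosEdge {d : ℕ} (Λ : Finset (Fin d → ℤ)) : Type :=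
  {e : Edge d // e.IsPos ∧ e.src ∈ Λ ∧ e.tgt ∈ Λ}

noncomputable instance {d : ℕ} (Λ : Finset (Fin d → ℤ)) : Fintype (PosEdge Λ) :=
  ((finite_edgesIn Λ).subset fun _ h => h.2).fintype

/-- Configurations `(Q_e)_{e ∈ E⁺_Λ}` of `SO(N)` matrices. -/
abbrev Config {d : ℕ} (Λ : Finset (Fin d → ℤ)) (N : ℕ) : Type := PosEdge Λ → SO N

open scoped Classical in
/-- The matrix `Q_e` for `e ∈ E_Λ`, with `Q_{e⁻¹} = Q_e⁻¹` for `e ∈ E⁺_Λ`.  (The value `1` for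
edges that are not in `E_Λ` is a convention that is never used.) -/
noncomputable def Config.at {d : ℕ} {Λ : Finset (Fin d → ℤ)} {N : ℕ} (Q : Config Λ N)
    (e : Edge d) : SO N :=
  if h : e.IsPos ∧ e.src ∈ Λ ∧ e.tgt ∈ Λ then Q ⟨e, h⟩
  else if h : e⁻¹.IsPos ∧ e⁻¹.src ∈ Λ ∧ e⁻¹.tgt ∈ Λ then (Q ⟨e⁻¹, h⟩)⁻¹
  else 1

/-- `Tr(Q_{e_1} ⋯ Q_{e_n})` for a list `e_1 ⋯ e_n` of edges. -/
noncomputable def pathTrace {d : ℕ} {Λ : Finset (Fin d → ℤ)} {N : ℕ} (Q : Config Λ N)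
    (ρ : List (Edge d)) : ℝ :=
  Matrix.trace ((ρ.map Q.at).prod : SO N).1

theorem pathTrace_congr {d : ℕ} {Λ : Finset (Fin d → ℤ)} {N : ℕ} (Q : Config Λ N)
    (ρ ρ' : List (Edge d)) (h : ρ ~r ρ') : pathTrace Q ρ = pathTrace Q ρ' := by
  obtain ⟨n, hn, rfl⟩ := List.isRotated_iff_mod.1 h
  rw [List.rotate_eq_drop_append_take hn]
  conv_lhs => rw [← List.take_append_drop n ρ]
  simp only [pathTrace, List.map_append, List.prod_append, Submonoid.coe_mul]
  exact Matrix.trace_mul_comm _ _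

/-- The Wilson loop variable `W_l`. -/
noncomputable def wilson {d : ℕ} {Λ : Finset (Fin d → ℤ)} {N : ℕ} (Q : Config Λ N)
    (l : Loop d) : ℝ :=
  Quotient.lift (s := List.IsRotated.setoid _) (pathTrace Q)
    (fun ρ ρ' h => pathTrace_congr Q ρ ρ' h) l.1

/-- The unnormalized density `exp(N β ∑_{p ∈ 𝒫⁺_Λ} Tr(Q_p))`. -/
noncomputable def gaugeWeight {d : ℕ} (Λ : Finset (Fin d → ℤ)) (N : ℕ) (β : ℝ)
    (Q : Config Λ N) : ℝ :=
  Real.exp (N * β * ∑ p ∈ posPlaquettesIn Λ, pathTrace Q p)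

/-- The normalizing constant `Z_{Λ,N,β}`. -/
noncomputable def partitionFunction {d : ℕ} (Λ : Finset (Fin d → ℤ)) (N : ℕ) (β : ℝ) : ℝ :=
  ∫ Q : Config Λ N, gaugeWeight Λ N β Q ∂(Measure.pi fun _ => haarSO N)

/-- The probability measure `μ_{Λ,N,β}` of `SO(N)` lattice gauge theory on `Λ`. -/
noncomputable def gaugeMeasure {d : ℕ} (Λ : Finset (Fin d → ℤ)) (N : ℕ) (β : ℝ) :
    Measure (Config Λ N) :=
  (Measure.pi fun _ => haarSO N).withDensity fun Q =>
    ENNReal.ofReal ((partitionFunction Λ N β)⁻¹ * gaugeWeight Λ N β Q)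

/-- `φ(s) = ⟨W_{l_1} ⋯ W_{l_n}⟩ / N^n`, where `(l_1, …, l_n)` is the minimal representation
of `s`. -/
noncomputable def phi {d : ℕ} (Λ : Finset (Fin d → ℤ)) (N : ℕ) (β : ℝ) (s : LoopSeq d) : ℝ :=
  (∫ Q, (s.minRep.map (wilson Q)).prod ∂(gaugeMeasure Λ N β)) / (N : ℝ) ^ s.minRep.length

end LatticeGauge

namespace LatticeGauge

/-! ### Haar measure on configurations -/

/-! The equation is an integration by parts on the compact group `SO(N)^{E⁺_Λ}`. Fix a positive edge
and a coordinate plane, and let `D` be the derivative along left multiplication of that edge's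
matrix by rotations `exp(tX)`, `X = E_ab - E_ba`. Product Haar measure is invariant under this flow,
so every `D`-derivative has Haar integral zero (`HasLieDeriv.integral_eq_zero`). Apply this to `(D
F) · w`, where `F` is the product of the variables `W_l / N` and `w` is the gauge weight: the
expectation of `D²F + (DF)(D log w)` vanishes. The sum of this function over all directions is the
generator of the Langevin dynamics, and the theorem is what its vanishing expectation says once the
sum is computed.

The computation is pointwise in `Q` (`sum_generator`) and rests on two contractions over ordered
pairs `(a, b)`: `∑ X M X = 2 (Mᵀ - Tr M)` and `∑ Tr(XA) Tr(XB) = 2 (Tr ABᵀ - Tr AB)`. A transpose of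
a holonomy is the holonomy of the reversed path, so every term is again a product of loop variables.
There are four kinds. Both derivatives hit the same location: `∑ X² = -2(N-1)`, which gives the left
side, one term for each edge. They hit two locations of one loop: splittings and twistings
(`sum_trace_edgeDeriv_mul_edgeDeriv_mul`). They hit two different loops: mergers
(`sum_trace_edgeDeriv_mul_trace`). One hits a loop and the other a plaquette of the action:
deformations, by the same contraction.

The powers of `N` come from the normalization `W_l / N`: a splitting adds a factor, a merger removes
one, and twistings and deformations keep the number. Passing to cores is harmless because `Q_e
Q_{e⁻¹} = 1`, and deleting null loops is harmless because their normalized variable is `1`. The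
common factor `2` arises because ordered pairs count each plane twice; it cancels at the end. -/

instance (N : ℕ) : SecondCountableTopology (SO N) := by
  have : SecondCountableTopology (Matrix (Fin N) (Fin N) ℝ) :=
    inferInstanceAs (SecondCountableTopology (Fin N → Fin N → ℝ))
  exact TopologicalSpace.Subtype.secondCountableTopology _

instance (N : ℕ) : Measure.IsHaarMeasure (haarSO N) := by
  unfold haarSO; infer_instance

instance (N : ℕ) : IsProbabilityMeasure (haarSO N) :=
  ⟨by simpa [haarSO] using Measure.haarMeasure_self (K₀ := (⊤ : TopologicalSpace.PositiveCompacts (SO N)))⟩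

/-- The product of the Haar measures on the edges. -/
noncomputable abbrev haarConfig {d : ℕ} (Λ : Finset (Fin d → ℤ)) (N : ℕ) : Measure (Config Λ N) :=
  Measure.pi fun _ => haarSO N

instance {d : ℕ} (Λ : Finset (Fin d → ℤ)) (N : ℕ) : BorelSpace (Config Λ N) := Pi.borelSpace

theorem integrable_of_continuous {d : ℕ} {Λ : Finset (Fin d → ℤ)} {N : ℕ} {μ : Measure (Config Λ N)}
    [IsFiniteMeasureOnCompacts μ] {f : Config Λ N → ℝ} (hf : Continuous f) : Integrable f μ :=
  hf.integrable_of_hasCompactSupport (HasCompactSupport.of_compactSpace f)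

/-! ### Rotations -/

/-- The generator `E_{ab} - E_{ba}` of the rotations in the `(a, b)` coordinate plane. -/
def skewGen {N : ℕ} (a b : Fin N) : Matrix (Fin N) (Fin N) ℝ :=
  Matrix.single a b 1 - Matrix.single b a 1

theorem transpose_skewGen {N : ℕ} (a b : Fin N) : (skewGen a b).transpose = -skewGen a b := by
  simp [skewGen, Matrix.transpose_sub]

/-- For `a ≠ b`, `-X²` is the projection onto the plane; for `a = b`, `X = 0`. The relation `X³ =
-X` collapses the exponential series to the closed form of `rotMatrix`, and the group law then
reduces to the addition formulas of sine and cosine. -/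
theorem skewGen_cube {N : ℕ} (a b : Fin N) :
    skewGen a b * (skewGen a b * skewGen a b) = -skewGen a b := by
  rcases eq_or_ne a b with rfl | h
  · simp [skewGen]
  · simp only [skewGen, sub_mul, mul_sub, Matrix.single_mul_single_same, ne_eq, h, h.symm,
      not_false_eq_true, Matrix.single_mul_single_of_ne, mul_one, sub_zero, zero_sub, mul_neg,
      neg_sub, sub_neg_eq_add]
    abel

/-- The matrix `exp (t X)` for `X = skewGen a b`. -/
noncomputable def rotMatrix {N : ℕ} (a b : Fin N) (t : ℝ) : Matrix (Fin N) (Fin N) ℝ :=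
  1 + Real.sin t • skewGen a b + (1 - Real.cos t) • (skewGen a b * skewGen a b)

theorem rotMatrix_zero {N : ℕ} (a b : Fin N) : rotMatrix a b 0 = 1 := by simp [rotMatrix]

theorem rotMatrix_add {N : ℕ} (a b : Fin N) (s t : ℝ) :
    rotMatrix a b (s + t) = rotMatrix a b s * rotMatrix a b t := by
  have h₃ := skewGen_cube a b
  have h₃' : (skewGen a b * skewGen a b) * skewGen a b = -skewGen a b := by rw [mul_assoc, h₃]
  have h₄ : (skewGen a b * skewGen a b) * (skewGen a b * skewGen a b) =
      -(skewGen a b * skewGen a b) := by rw [mul_assoc, h₃, mul_neg]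
  simp only [rotMatrix, add_mul, mul_add, smul_mul_assoc, mul_smul_comm, h₃, h₃', h₄, one_mul,
    mul_one, Real.sin_add, Real.cos_add]
  module

theorem transpose_rotMatrix {N : ℕ} (a b : Fin N) (t : ℝ) :
    (rotMatrix a b t).transpose = rotMatrix a b (-t) := by
  simp [rotMatrix, Matrix.transpose_add, Matrix.transpose_smul, Matrix.transpose_mul,
    transpose_skewGen]

theorem rotMatrix_mem {N : ℕ} (a b : Fin N) (t : ℝ) :
    rotMatrix a b t ∈ Matrix.specialOrthogonalGroup (Fin N) ℝ := by
  have ho : ∀ t, rotMatrix a b t * (rotMatrix a b t).transpose = 1 := fun t => by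
    rw [transpose_rotMatrix, ← rotMatrix_add, add_neg_cancel, rotMatrix_zero]
  rw [Matrix.mem_specialOrthogonalGroup_iff, Matrix.mem_orthogonalGroup_iff]
  refine ⟨by simpa [Matrix.star_eq_conjTranspose] using ho t, ?_⟩
  -- Orthogonality alone leaves the sign of the determinant open. The rotation by `t` is the square
  -- of the rotation by `t / 2`, so its determinant is the square of `±1`.
  have h := congrArg Matrix.det (ho (t / 2))
  rw [Matrix.det_mul, Matrix.det_transpose, Matrix.det_one] at h
  rw [← add_halves t, rotMatrix_add, Matrix.det_mul, h]

/-- The rotation by the angle `t` in the `(a, b)` coordinate plane. -/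
noncomputable def rot {N : ℕ} (a b : Fin N) (t : ℝ) : SO N := ⟨rotMatrix a b t, rotMatrix_mem a b t⟩

theorem rot_add {N : ℕ} (a b : Fin N) (s t : ℝ) : rot a b (s + t) = rot a b s * rot a b t :=
  Subtype.ext (rotMatrix_add a b s t)

theorem rot_zero {N : ℕ} (a b : Fin N) : rot a b 0 = 1 := Subtype.ext (rotMatrix_zero a b)

theorem coe_inv_SO {N : ℕ} (A : SO N) :
    (A⁻¹ : SO N).1 = (A.1).transpose := by
  change star A.1 = _
  simp [Matrix.star_eq_conjTranspose]

theorem hasDerivAt_rotMatrix {N : ℕ} (a b i j : Fin N) :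
    HasDerivAt (fun t => rotMatrix a b t i j) (skewGen a b i j) 0 := by
  have h := (((Real.hasDerivAt_sin 0).mul_const (skewGen a b i j)).const_add
    ((1 : Matrix (Fin N) (Fin N) ℝ) i j)).fun_add
    (((Real.hasDerivAt_cos 0).const_sub 1).mul_const ((skewGen a b * skewGen a b) i j))
  simpa [rotMatrix] using h

/-! ### Lie derivatives -/

/-- The label of a first order invariant differential operator: an edge and a coordinate plane. -/
abbrev Direction {d : ℕ} (Λ : Finset (Fin d → ℤ)) (N : ℕ) : Type := PosEdge Λ × Fin N × Fin N

open scoped Classical in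
/-- Multiply the matrix on one edge by a rotation. -/
noncomputable def flow {d : ℕ} {Λ : Finset (Fin d → ℤ)} {N : ℕ} (D : Direction Λ N) (t : ℝ) :
    Config Λ N := Pi.mulSingle D.1 (rot D.2.1 D.2.2 t)

theorem flow_add {d : ℕ} {Λ : Finset (Fin d → ℤ)} {N : ℕ} (D : Direction Λ N) (s t : ℝ) :
    flow D (s + t) = flow D s * flow D t := by
  classical
  rw [flow, rot_add, Pi.mulSingle_mul]; rfl

theorem flow_zero {d : ℕ} {Λ : Finset (Fin d → ℤ)} {N : ℕ} (D : Direction Λ N) :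
    flow D 0 = 1 := by
  classical
  rw [flow, rot_zero, Pi.mulSingle_one]

/-- `f'` is the derivative of `f` in the direction `D`. -/
structure HasLieDeriv {d : ℕ} {Λ : Finset (Fin d → ℤ)} {N : ℕ} (D : Direction Λ N)
    (f f' : Config Λ N → ℝ) : Prop where
  continuous : Continuous f
  continuous_deriv : Continuous f'
  hasDerivAt : ∀ Q, HasDerivAt (fun t => f (flow D t * Q)) (f' Q) 0

variable {d : ℕ} {Λ : Finset (Fin d → ℤ)} {N : ℕ} {D : Direction Λ N}

/-- The flow is a one-parameter group, so the derivative at time `t` from `Q` is the derivative at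
time `0` from the translated configuration. -/
theorem HasLieDeriv.hasDerivAt_flow {f f' : Config Λ N → ℝ} (h : HasLieDeriv D f f')
    (Q : Config Λ N) (t : ℝ) :
    HasDerivAt (fun t => f (flow D t * Q)) (f' (flow D t * Q)) t := by
  have h₁ := (h.hasDerivAt (flow D t * Q))
  rw [← sub_self t] at h₁
  have h₂ := h₁.comp_sub_const t t
  refine h₂.congr_of_eventuallyEq (Filter.Eventually.of_forall fun s => ?_)
  simp only [← mul_assoc, ← flow_add, sub_add_cancel]

/-- Integration by parts: the Haar integral of a Lie derivative vanishes. -/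
theorem HasLieDeriv.integral_eq_zero {f f' : Config Λ N → ℝ} (h : HasLieDeriv D f f') :
    ∫ Q, f' Q ∂haarConfig Λ N = 0 := by
  -- Compactness supplies a constant dominating function for differentiation under the integral.
  obtain ⟨C, hC⟩ : ∃ C, ∀ Q, ‖f' Q‖ ≤ C := by
    obtain ⟨C, hC⟩ := isCompact_univ.exists_bound_of_continuousOn h.continuous_deriv.continuousOn
    exact ⟨C, fun Q => hC Q trivial⟩
  have hs : ∀ {g : Config Λ N → ℝ}, Continuous g → ∀ t, Continuous fun Q => g (flow D t * Q) :=
    fun hg t => hg.comp (continuous_const.mul continuous_id)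
  have key := (hasDerivAt_integral_of_dominated_loc_of_deriv_le (μ := haarConfig Λ N)
    (F := fun t Q => f (flow D t * Q)) (F' := fun t Q => f' (flow D t * Q)) (x₀ := (0 : ℝ))
    (bound := fun _ => C) Filter.univ_mem
    (Filter.Eventually.of_forall fun t => (hs h.continuous t).aestronglyMeasurable)
    (integrable_of_continuous (hs h.continuous 0))
    (hs h.continuous_deriv 0).aestronglyMeasurable
    (Filter.Eventually.of_forall fun Q t _ => hC _) (integrable_const C)
    (Filter.Eventually.of_forall fun Q t _ => h.hasDerivAt_flow Q t)).2
  -- By left invariance `t ↦ ∫ f (flow D t * Q)` is constant, while its derivative at `0` is `∫ f'`.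
  simp only [integral_mul_left_eq_self f, integral_mul_left_eq_self f'] at key
  exact key.unique (hasDerivAt_const _ _)

theorem HasLieDeriv.congr_deriv {f f' g' : Config Λ N → ℝ} (h : HasLieDeriv D f f')
    (h' : ∀ Q, f' Q = g' Q) : HasLieDeriv D f g' := funext h' ▸ h

theorem HasLieDeriv.const (c : ℝ) : HasLieDeriv D (fun _ => c) (fun _ => 0) :=
  ⟨continuous_const, continuous_const, fun _ => hasDerivAt_const _ _⟩

theorem HasLieDeriv.mul {f f' g g' : Config Λ N → ℝ} (hf : HasLieDeriv D f f')
    (hg : HasLieDeriv D g g') :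
    HasLieDeriv D (fun Q => f Q * g Q) (fun Q => f' Q * g Q + f Q * g' Q) :=
  ⟨hf.continuous.mul hg.continuous,
    (hf.continuous_deriv.mul hg.continuous).add (hf.continuous.mul hg.continuous_deriv),
    fun Q => by simpa [flow_zero] using (hf.hasDerivAt Q).fun_mul (hg.hasDerivAt Q)⟩

theorem HasLieDeriv.neg {f f' : Config Λ N → ℝ} (hf : HasLieDeriv D f f') :
    HasLieDeriv D (fun Q => -f Q) (fun Q => -f' Q) :=
  ⟨hf.continuous.neg, hf.continuous_deriv.neg, fun Q => (hf.hasDerivAt Q).fun_neg⟩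

theorem HasLieDeriv.const_mul {f f' : Config Λ N → ℝ} (c : ℝ) (hf : HasLieDeriv D f f') :
    HasLieDeriv D (fun Q => c * f Q) (fun Q => c * f' Q) := by
  simpa using (HasLieDeriv.const (D := D) c).mul hf

theorem HasLieDeriv.sum {ι : Type*} {s : Finset ι} {f f' : ι → Config Λ N → ℝ}
    (h : ∀ i ∈ s, HasLieDeriv D (f i) (f' i)) :
    HasLieDeriv D (fun Q => ∑ i ∈ s, f i Q) (fun Q => ∑ i ∈ s, f' i Q) :=
  ⟨continuous_finsetSum _ fun i hi => (h i hi).continuous,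
    continuous_finsetSum _ fun i hi => (h i hi).continuous_deriv,
    fun Q => HasDerivAt.fun_sum fun i hi => (h i hi).hasDerivAt Q⟩

theorem HasLieDeriv.prod {ι : Type*} [DecidableEq ι] {s : Finset ι} {f f' : ι → Config Λ N → ℝ}
    (h : ∀ i ∈ s, HasLieDeriv D (f i) (f' i)) :
    HasLieDeriv D (fun Q => ∏ i ∈ s, f i Q)
      (fun Q => ∑ i ∈ s, f' i Q * ∏ j ∈ s.erase i, f j Q) :=
  ⟨continuous_finsetProd _ fun i hi => (h i hi).continuous,
    continuous_finsetSum _ fun i hi => (h i hi).continuous_deriv.mul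
      (continuous_finsetProd _ fun j hj => (h j (Finset.mem_of_mem_erase hj)).continuous),
    fun Q => by
      simpa [flow_zero, mul_comm] using HasDerivAt.fun_finsetProd fun i hi => (h i hi).hasDerivAt Q⟩

theorem HasLieDeriv.exp {f f' : Config Λ N → ℝ} (hf : HasLieDeriv D f f') :
    HasLieDeriv D (fun Q => Real.exp (f Q)) (fun Q => Real.exp (f Q) * f' Q) :=
  ⟨hf.continuous.rexp, hf.continuous.rexp.mul hf.continuous_deriv,
    fun Q => by simpa [flow_zero] using (hf.hasDerivAt Q).exp⟩

/-- Entrywise Lie derivative of a matrix valued function. -/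
def HasMatrixLieDeriv (D : Direction Λ N) (A A' : Config Λ N → Matrix (Fin N) (Fin N) ℝ) : Prop :=
  ∀ i j, HasLieDeriv D (fun Q => A Q i j) (fun Q => A' Q i j)

theorem HasMatrixLieDeriv.const (M : Matrix (Fin N) (Fin N) ℝ) :
    HasMatrixLieDeriv D (fun _ => M) (fun _ => 0) :=
  fun i j => HasLieDeriv.const (M i j)

theorem HasMatrixLieDeriv.neg {A A' : Config Λ N → Matrix (Fin N) (Fin N) ℝ}
    (h : HasMatrixLieDeriv D A A') : HasMatrixLieDeriv D (fun Q => -A Q) (fun Q => -A' Q) :=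
  fun i j => (h i j).neg

theorem HasMatrixLieDeriv.mul {A A' B B' : Config Λ N → Matrix (Fin N) (Fin N) ℝ}
    (hA : HasMatrixLieDeriv D A A') (hB : HasMatrixLieDeriv D B B') :
    HasMatrixLieDeriv D (fun Q => A Q * B Q) (fun Q => A' Q * B Q + A Q * B' Q) := fun i j => by
  simpa only [Matrix.mul_apply, Matrix.add_apply, ← Finset.sum_add_distrib] using
    HasLieDeriv.sum fun k _ => (hA i k).mul (hB k j)

theorem HasMatrixLieDeriv.trace {A A' : Config Λ N → Matrix (Fin N) (Fin N) ℝ}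
    (hA : HasMatrixLieDeriv D A A') :
    HasLieDeriv D (fun Q => (A Q).trace) (fun Q => (A' Q).trace) :=
  HasLieDeriv.sum fun k _ => hA k k

/-! ### Contractions over the coordinate planes -/

/-- Expanding both generators, the products `E_ab M E_ab` assemble the transpose and the products
`E_ab M E_ba` the trace. Each appears twice, since `(a, b)` and `(b, a)` contribute equally. -/
theorem sum_skewGen_mul_mul_skewGen {N : ℕ} (M : Matrix (Fin N) (Fin N) ℝ) :
    ∑ a, ∑ b, skewGen a b * M * skewGen a b = (2 : ℝ) • (M.transpose - M.trace • 1) := by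
  have h₁ : ∀ a b : Fin N, skewGen a b * M * skewGen a b =
      (Matrix.single a b (M.transpose a b) + Matrix.single b a (M.transpose b a)) -
      (Matrix.single a a (M b b) + Matrix.single b b (M a a)) := fun a b => by
    simp only [skewGen, sub_mul, mul_sub, Matrix.single_mul_mul_single, one_mul, mul_one,
      Matrix.transpose_apply]
    abel
  have h₂ : ∑ a, ∑ b, Matrix.single a b (M.transpose a b) = M.transpose :=
    (Matrix.matrix_eq_sum_single _).symm
  have h₃ : ∑ a, ∑ b, Matrix.single a a (M b b) = M.trace • (1 : Matrix (Fin N) (Fin N) ℝ) := by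
    simp only [← Matrix.sum_single_one, Finset.smul_sum, Matrix.smul_single, smul_eq_mul, mul_one,
      Matrix.trace, Matrix.diag_apply]
    exact Finset.sum_congr rfl fun a _ => 
      (map_sum (Matrix.singleAddMonoidHom (α := ℝ) a a) _ _).symm
  simp only [h₁, Finset.sum_sub_distrib, Finset.sum_add_distrib]
  rw [Finset.sum_comm (f := fun a b => Matrix.single b a (M.transpose b a)),
    Finset.sum_comm (f := fun a b => Matrix.single b b (M a a)), h₂, h₃]
  module

theorem trace_skewGen_mul {N : ℕ} (a b : Fin N) (A : Matrix (Fin N) (Fin N) ℝ) :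
    (skewGen a b * A).trace = A b a - A a b := by
  simp [skewGen, sub_mul, Matrix.trace_sub, Matrix.trace_single_mul]

/-- Each factor reads off the antisymmetric part of its matrix. This is the contraction for
derivatives that fall on two different traces. -/
theorem sum_trace_skewGen_mul_trace {N : ℕ} (A B : Matrix (Fin N) (Fin N) ℝ) :
    ∑ a, ∑ b, (skewGen a b * A).trace * (skewGen a b * B).trace =
      2 * ((A * B.transpose).trace - (A * B).trace) := by
  have h₁ : ∑ a, ∑ b, A a b * B a b = (A * B.transpose).trace := by
    simp [Matrix.trace, Matrix.mul_apply]
  have h₂ : ∑ a, ∑ b, A a b * B b a = (A * B).trace := by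
    simp [Matrix.trace, Matrix.mul_apply]
  simp only [trace_skewGen_mul, sub_mul, mul_sub, Finset.sum_sub_distrib]
  rw [Finset.sum_comm (f := fun a b => A b a * B b a),
    Finset.sum_comm (f := fun a b => A b a * B a b), h₁, h₂]
  ring

/-- The contraction for two derivatives inside a single trace: multiply
`sum_skewGen_mul_mul_skewGen` by `B` and take traces. -/
theorem sum_trace_skewGen_mul_skewGen_mul {N : ℕ} (A B : Matrix (Fin N) (Fin N) ℝ) :
    ∑ a, ∑ b, (skewGen a b * A * (skewGen a b * B)).trace =
      2 * ((A.transpose * B).trace - A.trace * B.trace) := by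
  have := congrArg (fun M => (M * B).trace) (sum_skewGen_mul_mul_skewGen A)
  simpa [Finset.sum_mul, Matrix.trace_sum, ← mul_assoc, sub_mul, Matrix.trace_sub] using this

/-! ### Holonomies and their derivatives -/

theorem Edge.not_isPos_inv {e : Edge d} (h : e.IsPos) : ¬ e⁻¹.IsPos := lt_asymm h

theorem Edge.isPos_or_isPos_inv (e : Edge d) : e.IsPos ∨ e⁻¹.IsPos := by
  refine lt_or_gt_of_ne fun h => ?_
  have h' : e.src = e.tgt := toLex.injective h
  simpa [h'] using e.adj

theorem Edge.inv_ne (e : Edge d) : e⁻¹ ≠ e := fun h => by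
  rcases e.isPos_or_isPos_inv with h' | h'
  · exact e.not_isPos_inv h' (h ▸ h')
  · exact e⁻¹.not_isPos_inv h' (by rw [h]; exact h ▸ h')

theorem Edge.inv_eq_iff {e f : Edge d} : e⁻¹ = f ↔ e = f⁻¹ :=
  ⟨fun h => h ▸ rfl, fun h => h ▸ rfl⟩

theorem Config.at_coe (Q : Config Λ N) (e : PosEdge Λ) : Q.at e.1 = Q e := by
  rw [Config.at, dif_pos e.2]

/-- No membership in `Λ` is needed: at most one of `e`, `e⁻¹` is positive, and the default value `1`
is its own inverse. -/
theorem Config.at_inv (Q : Config Λ N) (e : Edge d) : Q.at e⁻¹ = (Q.at e)⁻¹ := by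
  by_cases h : e.IsPos ∧ e.src ∈ Λ ∧ e.tgt ∈ Λ
  · rw [Config.at, dif_neg (fun h' => Edge.not_isPos_inv h.1 h'.1), Config.at, dif_pos h]
    exact dif_pos h
  · by_cases h' : e⁻¹.IsPos ∧ e⁻¹.src ∈ Λ ∧ e⁻¹.tgt ∈ Λ
    · rw [Config.at, dif_pos h', Config.at, dif_neg h, dif_pos h', inv_inv]
    · rw [Config.at, dif_neg h', Config.at, dif_neg h, dif_neg h', inv_one]
      exact dif_neg h

/-- The product of the matrices along a path. -/
noncomputable def holonomy (Q : Config Λ N) (ρ : List (Edge d)) : Matrix (Fin N) (Fin N) ℝ :=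
  ((ρ.map Q.at).prod : SO N).1

theorem pathTrace_eq (Q : Config Λ N) (ρ : List (Edge d)) :
    pathTrace Q ρ = (holonomy Q ρ).trace := rfl

theorem holonomy_nil (Q : Config Λ N) : holonomy Q [] = 1 := rfl

theorem holonomy_append (Q : Config Λ N) (ρ ρ' : List (Edge d)) :
    holonomy Q (ρ ++ ρ') = holonomy Q ρ * holonomy Q ρ' := by
  simp [holonomy]

theorem holonomy_cons (Q : Config Λ N) (e : Edge d) (ρ : List (Edge d)) :
    holonomy Q (e :: ρ) = (Q.at e).1 * holonomy Q ρ := by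
  simp [holonomy]

/-- In an orthogonal group inverse and transpose agree. This turns the transposes produced by the
contractions into the reversed paths of twistings and mergers. -/
theorem holonomy_pathInv (Q : Config Λ N) (ρ : List (Edge d)) :
    holonomy Q (pathInv ρ) = (holonomy Q ρ).transpose := by
  rw [holonomy, holonomy, ← coe_inv_SO, List.prod_inv_reverse, pathInv]
  simp [List.map_reverse, Function.comp_def, Config.at_inv]

theorem at_flow (D : Direction Λ N) (t : ℝ) (Q : Config Λ N) :
    (flow D t * Q).at D.1.1 = rot D.2.1 D.2.2 t * Q.at D.1.1 := by
  classical
  simp [Config.at_coe, flow]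

theorem at_flow_of_ne {D : Direction Λ N} (t : ℝ) (Q : Config Λ N) {f : Edge d}
    (h : f ≠ D.1.1) (h' : f⁻¹ ≠ D.1.1) : (flow D t * Q).at f = Q.at f := by
  classical
  have key : ∀ (g : PosEdge Λ), g.1 ≠ D.1.1 → (flow D t * Q) g = Q g := fun g hg => by
    rw [Pi.mul_apply, flow, Pi.mulSingle_eq_of_ne (fun h => hg (congrArg _ h)), one_mul]
  simp only [Config.at]
  split_ifs with h₁ h₂
  · exact key _ h
  · rw [key _ h']
  · rfl

open scoped Classical in
/-- The derivative of the matrix on the edge `f` in the direction `D`. -/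
noncomputable def edgeDeriv (D : Direction Λ N) (f : Edge d) (Q : Config Λ N) :
    Matrix (Fin N) (Fin N) ℝ :=
  if f = D.1.1 then skewGen D.2.1 D.2.2 * (Q.at f).1
  else if f⁻¹ = D.1.1 then -((Q.at f).1 * skewGen D.2.1 D.2.2) else 0

open scoped Classical in
/-- The second derivative of the matrix on the edge `f` in the direction `D`. -/
noncomputable def edgeDerivTwo (D : Direction Λ N) (f : Edge d) (Q : Config Λ N) :
    Matrix (Fin N) (Fin N) ℝ :=
  if f = D.1.1 then skewGen D.2.1 D.2.2 * edgeDeriv D f Q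
  else if f⁻¹ = D.1.1 then -(edgeDeriv D f Q * skewGen D.2.1 D.2.2) else 0

theorem continuous_at (f : Edge d) : Continuous fun Q : Config Λ N => Q.at f := by
  unfold Config.at
  split_ifs <;> fun_prop

theorem continuous_at_entry (f : Edge d) (i j : Fin N) :
    Continuous fun Q : Config Λ N => (Q.at f).1 i j :=
  (continuous_subtype_val.comp (continuous_at f)).matrix_elem i j

theorem hasMatrixLieDeriv_coe (D : Direction Λ N) :
    HasMatrixLieDeriv D (fun Q => (Q.at D.1.1).1)
      (fun Q => skewGen D.2.1 D.2.2 * (Q.at D.1.1).1) := fun i j => by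
  refine ⟨continuous_at_entry _ i j, ?_, fun Q => ?_⟩
  · simp only [Matrix.mul_apply]
    exact continuous_finsetSum _ fun k _ => continuous_const.mul (continuous_at_entry _ k j)
  · simp only [at_flow, Submonoid.coe_mul, Matrix.mul_apply]
    exact HasDerivAt.fun_sum fun k _ => (hasDerivAt_rotMatrix D.2.1 D.2.2 i k).mul_const _

theorem hasMatrixLieDeriv_at (D : Direction Λ N) (f : Edge d) :
    HasMatrixLieDeriv D (fun Q => (Q.at f).1) (edgeDeriv D f) := by
  unfold edgeDeriv
  split_ifs with h h'
  · rw [h]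
    exact hasMatrixLieDeriv_coe D
  -- On the reversed edge the matrix is the transpose of the one on `D.1`. Since `X` is skew, the
  -- entry `(i, j)` follows from the entry `(j, i)` of the positive case, with a sign.
  · obtain rfl := Edge.inv_eq_iff.1 h'
    have h₁ := hasMatrixLieDeriv_coe D
    intro i j
    have h₂ := h₁ j i
    simp only [Config.at_inv, coe_inv_SO] at h₂ ⊢
    have h₃ : ∀ A : Matrix (Fin N) (Fin N) ℝ, (-(A.transpose * skewGen D.2.1 D.2.2)) i j =
        (skewGen D.2.1 D.2.2 * A) j i := fun A => by
      rw [← Matrix.transpose_apply (_ * _), Matrix.transpose_mul, transpose_skewGen, mul_neg]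
    simpa only [h₃, Matrix.transpose_apply] using h₂
  · refine fun i j => ⟨continuous_at_entry _ i j, continuous_const, fun Q => ?_⟩
    simp only [at_flow_of_ne _ Q h h']
    exact hasDerivAt_const _ _

theorem hasMatrixLieDeriv_edgeDeriv (D : Direction Λ N) (f : Edge d) :
    HasMatrixLieDeriv D (edgeDeriv D f) (edgeDerivTwo D f) := by
  have h := hasMatrixLieDeriv_at D f
  rw [show edgeDeriv D f = fun Q => edgeDeriv D f Q from rfl]
  unfold edgeDerivTwo
  split_ifs with h₁ h₂
  · conv in fun Q => edgeDeriv D f Q => simp only [edgeDeriv, if_pos h₁]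
    simpa using (HasMatrixLieDeriv.const (skewGen D.2.1 D.2.2)).mul h
  · conv in fun Q => edgeDeriv D f Q => simp only [edgeDeriv, if_neg h₁, if_pos h₂]
    simpa using (h.mul (HasMatrixLieDeriv.const (skewGen D.2.1 D.2.2))).neg
  · simp only [edgeDeriv, if_neg h₁, if_neg h₂]
    exact HasMatrixLieDeriv.const 0

theorem hasMatrixLieDeriv_holonomy (D : Direction Λ N) (ρ : List (Edge d)) :
    HasMatrixLieDeriv D (fun Q => holonomy Q ρ) (fun Q => ∑ x : Fin ρ.length,
      holonomy Q (ρ.take x) * edgeDeriv D ρ[x] Q * holonomy Q (ρ.drop (x + 1))) := by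
  induction ρ with
  | nil => simpa [holonomy_nil] using HasMatrixLieDeriv.const 1
  | cons e ρ ih =>
    simpa [holonomy_cons, Fin.sum_univ_succ, Finset.mul_sum, mul_assoc, holonomy_nil] using
      (hasMatrixLieDeriv_at D e).mul ih

/-! ### Derivatives of Wilson loop variables -/

theorem length_arc_self (ρ : List (Edge d)) (x : Fin ρ.length) :
    (arc ρ x x).length = ρ.length - 1 := by
  have := x.2
  simp [arc]
  omega

/-- The splittings of `arc ρ x x` at one of its edges correspond to the locations `y ≠ x`. -/
theorem sum_arc_self {M : Type*} [AddCommMonoid M] (ρ : List (Edge d)) (x : Fin ρ.length)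
    (G : List (Edge d) → Edge d → List (Edge d) → M) :
    ∑ j : Fin (arc ρ x x).length,
      G ((arc ρ x x).take j) (arc ρ x x)[j] ((arc ρ x x).drop (j + 1)) =
    ∑ y ∈ Finset.univ.erase x, G (arc ρ x y) ρ[y] (arc ρ y x) := by
  have hx := x.2
  have hl := length_arc_self ρ x
  have hd : (ρ.drop (x + 1)).length = ρ.length - (x + 1) := List.length_drop
  have ht : (ρ.take x).length = x := by rw [List.length_take]; omega
  symm
  -- Position of location `y` in the word read cyclically from just after `x`: locations behind `x`
  -- come first, and those before `x` follow the `ρ.length - (x + 1)` edges of the tail.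
  refine Finset.sum_bij (fun y hy => ⟨if (x : ℕ) < y then y - (x + 1) else ρ.length - (x + 1) + y, ?_⟩)
    (fun _ _ => Finset.mem_univ _) ?_ ?_ ?_
  · have h₁ := y.2
    have h₂ : (y : ℕ) ≠ x := fun h => (Finset.mem_erase.1 hy).1 (Fin.ext h)
    rw [hl]
    split_ifs <;> omega
  · intro y hy z hz h
    have h₁ := y.2
    have h₂ := z.2
    have h₃ : (y : ℕ) ≠ x := fun h => (Finset.mem_erase.1 hy).1 (Fin.ext h)
    have h₄ : (z : ℕ) ≠ x := fun h => (Finset.mem_erase.1 hz).1 (Fin.ext h)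
    rw [Fin.mk.injEq] at h
    ext
    split_ifs at h <;> omega
  · intro j _
    have hj := j.2
    by_cases h : (j : ℕ) < ρ.length - (x + 1)
    · refine ⟨⟨j + (x + 1), by omega⟩, ?_, ?_⟩
      · simp only [Finset.mem_erase, Finset.mem_univ, and_true, ne_eq, Fin.ext_iff]
        omega
      · ext
        simp only
        split_ifs <;> omega
    · refine ⟨⟨j - (ρ.length - (x + 1)), by omega⟩, ?_, ?_⟩
      · simp only [Finset.mem_erase, Finset.mem_univ, and_true, ne_eq, Fin.ext_iff]
        omega
      · ext
        simp only
        split_ifs <;> omega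
  · intro y hy
    have h₁ := y.2
    have h₃ : (y : ℕ) ≠ x := fun h => (Finset.mem_erase.1 hy).1 (Fin.ext h)
    have ha : arc ρ x x = ρ.drop (x + 1) ++ ρ.take x := by rw [arc, if_neg (lt_irrefl _)]
    have hg : (arc ρ x x)[if (x : ℕ) < y then (y : ℕ) - (x + 1) else ρ.length - (x + 1) + y]? =
        some ρ[y] := by
      rw [ha]
      split_ifs with h
      · rw [List.getElem?_append_left (by omega), List.getElem?_drop,
          show (x : ℕ) + 1 + (y - (x + 1)) = y by omega]
        simp
      · rw [List.getElem?_append_right (by omega), hd, Nat.add_sub_cancel_left,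
          List.getElem?_take_of_lt (by omega)]
        simp
    have hg' := (List.getElem?_eq_some_iff.1 hg).2
    simp only [Fin.getElem_fin] at hg' ⊢
    rw [hg', ha]
    congr 1
    · split_ifs with h
      · rw [arc, if_pos h, List.take_append_of_le_length (by omega)]
      · rw [arc, if_neg h, ← hd, List.take_length_add_append, List.take_take,
          Nat.min_eq_left (by omega)]
    · split_ifs with h
      · rw [arc, if_neg (by omega), List.drop_append_of_le_length (by omega), List.drop_drop]
        congr 2
        omega
      · rw [arc, if_pos (by omega), ← hd, add_assoc, List.drop_length_add_append, List.drop_take]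

/-- The derivative of `pathTrace Q ρ`. -/
noncomputable def traceDeriv (D : Direction Λ N) (ρ : List (Edge d)) (Q : Config Λ N) : ℝ :=
  ∑ x : Fin ρ.length, (edgeDeriv D ρ[x] Q * holonomy Q (arc ρ x x)).trace

/-- The second derivative of `pathTrace Q ρ`. -/
noncomputable def traceDerivTwo (D : Direction Λ N) (ρ : List (Edge d)) (Q : Config Λ N) : ℝ :=
  ∑ x : Fin ρ.length, ((edgeDerivTwo D ρ[x] Q * holonomy Q (arc ρ x x)).trace +
    ∑ y ∈ Finset.univ.erase x, (edgeDeriv D ρ[x] Q * holonomy Q (arc ρ x y) *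
      (edgeDeriv D ρ[y] Q * holonomy Q (arc ρ y x))).trace)

theorem hasLieDeriv_pathTrace (D : Direction Λ N) (ρ : List (Edge d)) :
    HasLieDeriv D (fun Q => pathTrace Q ρ) (traceDeriv D ρ) := by
  have h := (hasMatrixLieDeriv_holonomy D ρ).trace
  refine h.congr_deriv fun Q => ?_
  rw [Matrix.trace_sum, traceDeriv]
  refine Finset.sum_congr rfl fun x _ => ?_
  -- Cyclicity of the trace moves the part before `x` behind the part after it; together they form
  -- `arc ρ x x`.
  rw [mul_assoc, Matrix.trace_mul_comm, mul_assoc, ← holonomy_append, arc, if_neg (lt_irrefl _)]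

theorem hasLieDeriv_traceDeriv (D : Direction Λ N) (ρ : List (Edge d)) :
    HasLieDeriv D (traceDeriv D ρ) (traceDerivTwo D ρ) := by
  have h := HasLieDeriv.sum (s := Finset.univ) fun (x : Fin ρ.length) _ =>
    ((hasMatrixLieDeriv_edgeDeriv D ρ[x]).mul (hasMatrixLieDeriv_holonomy D (arc ρ x x))).trace
  refine h.congr_deriv fun Q => ?_
  rw [traceDerivTwo]
  refine Finset.sum_congr rfl fun x _ => ?_
  rw [Matrix.trace_add, Finset.mul_sum, Matrix.trace_sum]
  congr 1
  -- The Leibniz rule on `arc ρ x x` differentiates each of its edges once, and these are the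
  -- locations `y ≠ x`.
  rw [← sum_arc_self ρ x fun σ f τ => (edgeDeriv D ρ[x] Q * holonomy Q σ *
      (edgeDeriv D f Q * holonomy Q τ)).trace]
  simp only [mul_assoc]

/-! ### Contraction of derivatives over all directions -/

/-- The edge joins two vertices of `Λ`. -/
def InLattice (Λ : Finset (Fin d → ℤ)) (f : Edge d) : Prop := f.src ∈ Λ ∧ f.tgt ∈ Λ

theorem InLattice.exists_posEdge {f : Edge d} (h : InLattice Λ f) :
    ∃ e : PosEdge Λ, f = e.1 ∨ f⁻¹ = e.1 :=
  f.isPos_or_isPos_inv.elim (fun h' => ⟨⟨f, h', h.1, h.2⟩, Or.inl rfl⟩)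
    fun h' => ⟨⟨f⁻¹, h', h.2, h.1⟩, Or.inr rfl⟩

theorem edgeDeriv_eq_zero {D : Direction Λ N} {f : Edge d} (h : f ≠ D.1.1) (h' : f⁻¹ ≠ D.1.1)
    (Q : Config Λ N) : edgeDeriv D f Q = 0 := by
  rw [edgeDeriv, if_neg h, if_neg h']

theorem edgeDeriv_self (D : Direction Λ N) (Q : Config Λ N) :
    edgeDeriv D D.1.1 Q = skewGen D.2.1 D.2.2 * (Q.at D.1.1).1 := by
  rw [edgeDeriv, if_pos rfl]

theorem edgeDeriv_inv (D : Direction Λ N) (Q : Config Λ N) :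
    edgeDeriv D D.1.1⁻¹ Q = -((Q.at D.1.1).1.transpose * skewGen D.2.1 D.2.2) := by
  rw [edgeDeriv, if_neg (Edge.inv_ne _), if_pos (Edge.inv_inv _), Config.at_inv, coe_inv_SO]

theorem edgeDerivTwo_self (D : Direction Λ N) (Q : Config Λ N) : edgeDerivTwo D D.1.1 Q =
    skewGen D.2.1 D.2.2 * (skewGen D.2.1 D.2.2 * (Q.at D.1.1).1) := by
  rw [edgeDerivTwo, if_pos rfl, edgeDeriv_self]

theorem edgeDerivTwo_inv (D : Direction Λ N) (Q : Config Λ N) : edgeDerivTwo D D.1.1⁻¹ Q =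
    (Q.at D.1.1).1.transpose * skewGen D.2.1 D.2.2 * skewGen D.2.1 D.2.2 := by
  rw [edgeDerivTwo, if_neg (Edge.inv_ne _), if_pos (Edge.inv_inv _), edgeDeriv_inv, neg_mul, neg_neg]

/-- Only the directions of the edge underlying `f` contribute to a sum that involves derivatives
of the matrix on `f`. -/
theorem sum_direction_eq {f : Edge d} {e : PosEdge Λ} (he : f = e.1 ∨ f⁻¹ = e.1)
    (F : Direction Λ N → ℝ) (hF : ∀ D : Direction Λ N, f ≠ D.1.1 → f⁻¹ ≠ D.1.1 → F D = 0) :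
    ∑ D, F D = ∑ a, ∑ b, F (e, a, b) := by
  rw [Fintype.sum_prod_type, Finset.sum_eq_single e]
  · rw [Fintype.sum_prod_type]
  · intro e' _ hne
    refine Finset.sum_eq_zero fun p _ => hF _ ?_ ?_
    · rintro rfl
      rcases he with he | he
      · exact hne (Subtype.ext he)
      · exact Edge.not_isPos_inv e'.2.1 (he ▸ e.2.1)
    · intro h
      obtain rfl := Edge.inv_eq_iff.1 h
      rcases he with he | he
      · exact Edge.not_isPos_inv e'.2.1 (he ▸ e.2.1)
      · exact hne (Subtype.ext he)
  · exact fun h => absurd (Finset.mem_univ _) h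

theorem at_mul_transpose (Q : Config Λ N) (f : Edge d) :
    (Q.at f).1 * (Q.at f).1.transpose = 1 := by
  rw [← coe_inv_SO, ← Submonoid.coe_mul, mul_inv_cancel, Submonoid.coe_one]

theorem transpose_mul_at (Q : Config Λ N) (f : Edge d) :
    (Q.at f).1.transpose * (Q.at f).1 = 1 := by
  rw [← coe_inv_SO, ← Submonoid.coe_mul, inv_mul_cancel, Submonoid.coe_one]

theorem transpose_at_inv (Q : Config Λ N) (f : Edge d) :
    (Q.at f⁻¹).1 = (Q.at f).1.transpose := by
  rw [Config.at_inv, coe_inv_SO]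

/-- The Casimir identity `∑ X² = -2(N-1)`, obtained from the contraction with `A = 1` and `Tr 1 =
N`. It is the source of the factor `N - 1` in the master loop equation. -/
theorem sum_trace_edgeDerivTwo_mul {f : Edge d} (hf : InLattice Λ f) (Q : Config Λ N)
    (A : Matrix (Fin N) (Fin N) ℝ) :
    ∑ D : Direction Λ N, (edgeDerivTwo D f Q * A).trace =
      -(2 * ((N : ℝ) - 1) * ((Q.at f).1 * A).trace) := by
  obtain ⟨e, he⟩ := hf.exists_posEdge
  rw [sum_direction_eq he _ fun D h₁ h₂ => by
    rw [edgeDerivTwo, if_neg h₁, if_neg h₂, zero_mul, Matrix.trace_zero]]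
  have key : ∀ B : Matrix (Fin N) (Fin N) ℝ, ∑ a, ∑ b, (skewGen a b * (skewGen a b * B)).trace =
      -(2 * ((N : ℝ) - 1) * B.trace) := fun B => by
    have := sum_trace_skewGen_mul_skewGen_mul (1 : Matrix (Fin N) (Fin N) ℝ) B
    simp only [mul_one, Matrix.transpose_one, one_mul, Matrix.trace_one, Fintype.card_fin] at this
    rw [this]
    ring
  rcases he with rfl | he
  · rw [← key]
    refine Finset.sum_congr rfl fun a _ => Finset.sum_congr rfl fun b _ => ?_
    rw [edgeDerivTwo_self (e, a, b)]
    simp only [mul_assoc]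
  · obtain rfl := Edge.inv_eq_iff.1 he
    rw [Matrix.trace_mul_comm (Subtype.val _), ← key]
    refine Finset.sum_congr rfl fun a _ => Finset.sum_congr rfl fun b _ => ?_
    rw [edgeDerivTwo_inv (e, a, b), transpose_at_inv, mul_assoc, mul_assoc, Matrix.trace_mul_comm]
    simp only [mul_assoc]

open scoped Classical in
-- With `A` and `B` the holonomies of the two arcs between the locations, equal edges give a
-- negative twisting minus a positive splitting, and inverse edges give a negative splitting minus a
-- positive twisting. The result does not depend on whether `f` or `f⁻¹` is the positive edge, but
-- the proofs differ, since rotations act on the left of `Q_e` and hence on the right of `Q_{e⁻¹}`.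
theorem sum_trace_edgeDeriv_mul_edgeDeriv_mul {f : Edge d} (hf : InLattice Λ f) (g : Edge d)
    (Q : Config Λ N) (A B : Matrix (Fin N) (Fin N) ℝ) :
    ∑ D : Direction Λ N, (edgeDeriv D f Q * A * (edgeDeriv D g Q * B)).trace =
      2 * ((if g = f then (A.transpose * B).trace -
          ((Q.at f).1 * B).trace * (A * (Q.at f).1).trace else 0) +
        if g = f⁻¹ then B.trace * A.trace -
          ((Q.at f).1 * (A.transpose * ((Q.at f⁻¹).1 * B))).trace else 0) := by
  obtain ⟨e, he⟩ := hf.exists_posEdge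
  rw [sum_direction_eq he _ fun D h₁ h₂ => by
    rw [edgeDeriv_eq_zero h₁ h₂, zero_mul, zero_mul, Matrix.trace_zero]]
  by_cases hgf : g = f
  · obtain rfl := hgf
    rw [if_pos rfl, if_neg (Edge.inv_ne g).symm, add_zero]
    rcases he with rfl | he
    · have := sum_trace_skewGen_mul_skewGen_mul ((Q.at e.1).1 * A) ((Q.at e.1).1 * B)
      rw [Matrix.transpose_mul, mul_assoc, ← mul_assoc _ _ B, transpose_mul_at, one_mul,
        Matrix.trace_mul_comm _ A, mul_comm (Matrix.trace _) (Matrix.trace _)] at this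
      rw [← this]
      refine Finset.sum_congr rfl fun a _ => Finset.sum_congr rfl fun b _ => ?_
      rw [edgeDeriv_self (e, a, b)]
      simp only [mul_assoc]
    · obtain rfl := Edge.inv_eq_iff.1 he
      -- Both derivatives carry a minus sign, and the signs cancel. The edge matrices stand to the
      -- left of the generators, so cyclicity attaches them to the right ends of `A` and `B`.
      have := sum_trace_skewGen_mul_skewGen_mul (A * (Q.at e.1⁻¹).1) (B * (Q.at e.1⁻¹).1)
      rw [Matrix.transpose_mul, Matrix.trace_mul_comm, mul_assoc, ← mul_assoc _ _ A.transpose,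
        at_mul_transpose, one_mul, Matrix.trace_mul_comm B A.transpose, Matrix.trace_mul_comm B,
        mul_comm (Matrix.trace _) (Matrix.trace _)] at this
      rw [← this]
      refine Finset.sum_congr rfl fun a _ => Finset.sum_congr rfl fun b _ => ?_
      rw [edgeDeriv_inv (e, a, b), transpose_at_inv]
      simp only [neg_mul, mul_neg, neg_neg, mul_assoc]
      rw [Matrix.trace_mul_comm]
      simp only [mul_assoc]
  rw [if_neg hgf]
  by_cases hgf' : g = f⁻¹
  · obtain rfl := hgf'
    rw [if_pos rfl, zero_add, transpose_at_inv]
    rcases he with rfl | he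
    · have := sum_trace_skewGen_mul_skewGen_mul ((Q.at e.1).1 * A * (Q.at e.1).1.transpose) B
      rw [Matrix.trace_mul_comm (_ * A), ← mul_assoc (Matrix.transpose _), transpose_mul_at, one_mul,
        Matrix.transpose_mul, Matrix.transpose_mul, Matrix.transpose_transpose] at this
      -- Exactly one of the two edges is traversed backwards, which reverses the sign of the
      -- contraction.
      have h₂ := congrArg Neg.neg this
      rw [← mul_neg, neg_sub, ← Finset.sum_neg_distrib, mul_comm A.trace] at h₂
      simp only [mul_assoc] at h₂
      rw [← h₂]
      refine Finset.sum_congr rfl fun a _ => ?_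
      rw [← Finset.sum_neg_distrib]
      refine Finset.sum_congr rfl fun b _ => ?_
      rw [edgeDeriv_self (e, a, b), edgeDeriv_inv (e, a, b)]
      simp only [neg_mul, mul_neg, Matrix.trace_neg, mul_assoc]
    · obtain rfl := Edge.inv_eq_iff.1 he
      have := sum_trace_skewGen_mul_skewGen_mul A ((Q.at e.1).1 * B * (Q.at e.1).1.transpose)
      have hA : (A.transpose * ((Q.at e.1).1 * B * (Q.at e.1).1.transpose)).trace =
          ((Q.at e.1).1.transpose * (A.transpose * ((Q.at e.1).1 * B))).trace := by
        rw [← mul_assoc, Matrix.trace_mul_comm]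
      have hB : ((Q.at e.1).1 * B * (Q.at e.1).1.transpose).trace = B.trace := by
        rw [Matrix.trace_mul_comm, ← mul_assoc, transpose_mul_at, one_mul]
      rw [hA, hB] at this
      have h₂ := congrArg Neg.neg this
      rw [← mul_neg, neg_sub, ← Finset.sum_neg_distrib, mul_comm A.trace] at h₂
      rw [transpose_at_inv, Matrix.transpose_transpose]
      rw [← h₂]
      refine Finset.sum_congr rfl fun a _ => ?_
      rw [← Finset.sum_neg_distrib]
      refine Finset.sum_congr rfl fun b _ => ?_
      rw [Edge.inv_inv, edgeDeriv_self (e, a, b), edgeDeriv_inv (e, a, b)]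
      simp only [neg_mul, Matrix.trace_neg, mul_assoc]
      rw [Matrix.trace_mul_comm (Matrix.transpose _)]
      simp only [mul_assoc]
  · rw [if_neg hgf', add_zero, mul_zero]
    refine Finset.sum_eq_zero fun a _ => Finset.sum_eq_zero fun b _ => ?_
    rw [edgeDeriv_eq_zero (f := g), zero_mul, mul_zero, Matrix.trace_zero]
    · rintro rfl
      rcases he with he | he
      · exact hgf he.symm
      · exact hgf' he.symm
    · intro h
      obtain rfl := Edge.inv_eq_iff.1 h
      rcases he with he | he
      · exact hgf' (he ▸ rfl)
      · exact hgf (Edge.inv_eq_iff.1 he).symm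

theorem trace_edgeDeriv_self_mul (D : Direction Λ N) (Q : Config Λ N)
    (A : Matrix (Fin N) (Fin N) ℝ) : (edgeDeriv D D.1.1 Q * A).trace =
      (skewGen D.2.1 D.2.2 * ((Q.at D.1.1).1 * A)).trace := by
  rw [edgeDeriv_self, mul_assoc]

theorem trace_edgeDeriv_inv_mul (D : Direction Λ N) (Q : Config Λ N)
    (A : Matrix (Fin N) (Fin N) ℝ) : (edgeDeriv D D.1.1⁻¹ Q * A).trace =
      -(skewGen D.2.1 D.2.2 * (A * (Q.at D.1.1).1.transpose)).trace := by
  rw [edgeDeriv_inv, neg_mul, Matrix.trace_neg, mul_assoc, Matrix.trace_mul_comm, mul_assoc]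

open scoped Classical in
-- With `A` and `B` the holonomies of the two words with the differentiated edge removed, both cases
-- give the negative merger minus the positive one. When `g = f⁻¹` the sign from the reversed edge
-- exchanges the roles of `B` and its transpose.
theorem sum_trace_edgeDeriv_mul_trace {f : Edge d} (hf : InLattice Λ f) (g : Edge d)
    (Q : Config Λ N) (A B : Matrix (Fin N) (Fin N) ℝ) :
    ∑ D : Direction Λ N, (edgeDeriv D f Q * A).trace * (edgeDeriv D g Q * B).trace =
      2 * ((if g = f then (B.transpose * A).trace -
          ((Q.at f).1 * (B * ((Q.at f).1 * A))).trace else 0) +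
        if g = f⁻¹ then (B * A).trace -
          ((Q.at f).1 * (B.transpose * ((Q.at f).1 * A))).trace else 0) := by
  obtain ⟨e, he⟩ := hf.exists_posEdge
  rw [sum_direction_eq he _ fun D h₁ h₂ => by
    rw [edgeDeriv_eq_zero h₁ h₂, zero_mul, Matrix.trace_zero, zero_mul]]
  by_cases hgf : g = f
  · obtain rfl := hgf
    rw [if_pos rfl, if_neg (Edge.inv_ne g).symm, add_zero]
    rcases he with rfl | he
    · have := sum_trace_skewGen_mul_trace ((Q.at e.1).1 * A) ((Q.at e.1).1 * B)
      have h₁ : ((Q.at e.1).1 * A * ((Q.at e.1).1 * B).transpose).trace =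
          (B.transpose * A).trace := by
        rw [Matrix.trace_mul_comm, Matrix.transpose_mul, mul_assoc, ← mul_assoc _ _ A,
          transpose_mul_at, one_mul]
      rw [h₁, Matrix.trace_mul_comm _ ((Q.at e.1).1 * B), mul_assoc] at this
      rw [← this]
      refine Finset.sum_congr rfl fun a _ => Finset.sum_congr rfl fun b _ => ?_
      rw [trace_edgeDeriv_self_mul (e, a, b), trace_edgeDeriv_self_mul (e, a, b)]
    · obtain rfl := Edge.inv_eq_iff.1 he
      have := sum_trace_skewGen_mul_trace (A * (Q.at e.1).1.transpose) (B * (Q.at e.1).1.transpose)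
      have h₁ : (A * (Q.at e.1).1.transpose * (B * (Q.at e.1).1.transpose).transpose).trace =
          (B.transpose * A).trace := by
        rw [Matrix.transpose_mul, Matrix.transpose_transpose, mul_assoc, ← mul_assoc _ _ B.transpose,
          transpose_mul_at, one_mul, Matrix.trace_mul_comm]
      have h₂ : (A * (Q.at e.1).1.transpose * (B * (Q.at e.1).1.transpose)).trace =
          ((Q.at e.1).1.transpose * (B * ((Q.at e.1).1.transpose * A))).trace := by
        rw [mul_assoc, Matrix.trace_mul_comm]
        simp only [mul_assoc]
      rw [h₁, h₂] at this
      rw [transpose_at_inv, ← this]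
      refine Finset.sum_congr rfl fun a _ => Finset.sum_congr rfl fun b _ => ?_
      rw [trace_edgeDeriv_inv_mul (e, a, b), trace_edgeDeriv_inv_mul (e, a, b), neg_mul_neg]
  rw [if_neg hgf]
  by_cases hgf' : g = f⁻¹
  · obtain rfl := hgf'
    rw [if_pos rfl, zero_add]
    rcases he with rfl | he
    · have := sum_trace_skewGen_mul_trace ((Q.at e.1).1 * A) (B * (Q.at e.1).1.transpose)
      have h₁ : ((Q.at e.1).1 * A * (B * (Q.at e.1).1.transpose).transpose).trace =
          ((Q.at e.1).1 * (B.transpose * ((Q.at e.1).1 * A))).trace := by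
        rw [Matrix.transpose_mul, Matrix.transpose_transpose, Matrix.trace_mul_comm, mul_assoc]
      have h₂ : ((Q.at e.1).1 * A * (B * (Q.at e.1).1.transpose)).trace = (B * A).trace := by
        rw [Matrix.trace_mul_comm, mul_assoc, ← mul_assoc _ _ A, transpose_mul_at, one_mul]
      rw [h₁, h₂] at this
      have h₃ := congrArg Neg.neg this
      rw [← mul_neg, neg_sub, ← Finset.sum_neg_distrib] at h₃
      rw [← h₃]
      refine Finset.sum_congr rfl fun a _ => ?_
      rw [← Finset.sum_neg_distrib]
      refine Finset.sum_congr rfl fun b _ => ?_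
      rw [trace_edgeDeriv_self_mul (e, a, b), trace_edgeDeriv_inv_mul (e, a, b), mul_neg]
    · obtain rfl := Edge.inv_eq_iff.1 he
      have := sum_trace_skewGen_mul_trace (A * (Q.at e.1).1.transpose) ((Q.at e.1).1 * B)
      have h₁ : (A * (Q.at e.1).1.transpose * ((Q.at e.1).1 * B).transpose).trace =
          ((Q.at e.1).1.transpose * (B.transpose * ((Q.at e.1).1.transpose * A))).trace := by
        rw [Matrix.transpose_mul, Matrix.trace_mul_comm, ← mul_assoc, Matrix.trace_mul_comm]
        simp only [mul_assoc]
      have h₂ : (A * (Q.at e.1).1.transpose * ((Q.at e.1).1 * B)).trace = (B * A).trace := by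
        rw [mul_assoc, ← mul_assoc _ _ B, transpose_mul_at, one_mul, Matrix.trace_mul_comm]
      rw [h₁, h₂] at this
      have h₃ := congrArg Neg.neg this
      rw [← mul_neg, neg_sub, ← Finset.sum_neg_distrib] at h₃
      rw [transpose_at_inv, ← h₃]
      refine Finset.sum_congr rfl fun a _ => ?_
      rw [← Finset.sum_neg_distrib]
      refine Finset.sum_congr rfl fun b _ => ?_
      rw [Edge.inv_inv, trace_edgeDeriv_inv_mul (e, a, b), trace_edgeDeriv_self_mul (e, a, b),
        neg_mul]
  · rw [if_neg hgf', add_zero, mul_zero]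
    refine Finset.sum_eq_zero fun a _ => Finset.sum_eq_zero fun b _ => ?_
    rw [edgeDeriv_eq_zero (f := g), zero_mul, Matrix.trace_zero, mul_zero]
    · rintro rfl
      rcases he with he | he
      · exact hgf he.symm
      · exact hgf' he.symm
    · intro h
      obtain rfl := Edge.inv_eq_iff.1 h
      rcases he with he | he
      · exact hgf' (he ▸ rfl)
      · exact hgf (Edge.inv_eq_iff.1 he).symm

/-! ### Wilson loop variables of the results of the operations -/

theorem wilson_eq_pathTrace (Q : Config Λ N) (l : Loop d) : wilson Q l = pathTrace Q l.path := by
  rw [wilson, ← l.coe_path]; rfl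

/-- Erasing a backtrack removes `Q_e Q_e⁻¹ = 1` from the product, so loop variables can be computed
on the unreduced words that define the operations. -/
theorem wilson_coreLoop (Q : Config Λ N) (ρ : List (Edge d))
    (h : IsClosed (ρ : Cycle (Edge d))) : wilson Q (coreLoop ρ h) = pathTrace Q ρ := by
  have key : ∀ c c' : Cycle (Edge d), Relation.ReflTransGen Erase c c' →
      Quotient.lift (s := List.IsRotated.setoid _) (pathTrace Q)
        (fun ρ ρ' h => pathTrace_congr Q ρ ρ' h) c =
      Quotient.lift (s := List.IsRotated.setoid _) (pathTrace Q)
        (fun ρ ρ' h => pathTrace_congr Q ρ ρ' h) c' := by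
    intro c c' hc
    induction hc with
    | refl => rfl
    | tail _ h₂ ih =>
      rw [ih]
      obtain ⟨e, σ, rfl, rfl⟩ := h₂
      change pathTrace Q (e :: e⁻¹ :: σ) = pathTrace Q σ
      simp only [pathTrace_eq, holonomy_cons, transpose_at_inv, ← mul_assoc, at_mul_transpose,
        one_mul]
  exact (key _ _ (core_spec _).1).symm

theorem wilson_null (Q : Config Λ N) : wilson Q (Loop.null d) = N := by
  change pathTrace Q [] = N
  simp [pathTrace_eq, holonomy_nil]

theorem pathTrace_eq_arc (Q : Config Λ N) (ρ : List (Edge d)) (x : Fin ρ.length) :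
    pathTrace Q ρ = ((Q.at ρ[x]).1 * holonomy Q (arc ρ x x)).trace := by
  rw [pathTrace_congr Q _ _ (Cycle.coe_eq_coe.1 (coe_eq_arc ρ x)), pathTrace_eq, holonomy_cons]

theorem Loop.length_path (l : Loop d) : l.path.length = l.length := by
  rw [Loop.length, ← l.coe_path, Cycle.length_coe]

open scoped Classical in
theorem sum_traceDerivTwo_path (l : Loop d) (hl : ∀ f ∈ l.path, InLattice Λ f)
    (Q : Config Λ N) :
    ∑ D : Direction Λ N, traceDerivTwo D l.path Q =
      2 * (-(((N : ℝ) - 1) * l.length * wilson Q l) + ∑ x, ∑ y,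
        ((if h : SameAt l.path x y then wilson Q (l.negTwist x y h) -
            wilson Q (l.posSplit₁ x y h) * wilson Q (l.posSplit₂ x y h) else 0) +
          if h : InvAt l.path x y then wilson Q (l.negSplit₁ x y h) *
            wilson Q (l.negSplit₂ x y h) - wilson Q (l.posTwist x y h) else 0)) := by
  have hmem : ∀ x : Fin l.path.length, InLattice Λ l.path[x] := fun x => hl _ (List.getElem_mem _)
  have h₁ : ∑ x : Fin l.path.length, ((N : ℝ) - 1) *
      ((Q.at l.path[x]).1 * holonomy Q (arc l.path x x)).trace =
      ((N : ℝ) - 1) * l.length * wilson Q l := by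
    simp only [← pathTrace_eq_arc, Finset.sum_const, Finset.card_univ, Fintype.card_fin,
      l.length_path, wilson_eq_pathTrace, nsmul_eq_mul]
    ring
  simp only [traceDerivTwo]
  rw [Finset.sum_comm, ← h₁, ← Finset.sum_neg_distrib, ← Finset.sum_add_distrib, Finset.mul_sum]
  refine Finset.sum_congr rfl fun x _ => ?_
  rw [Finset.sum_add_distrib, sum_trace_edgeDerivTwo_mul (hmem x), mul_add, Finset.mul_sum]
  congr 1
  · ring
  -- The terms with `y = x` on the right are zero, because `SameAt` and `InvAt` require distinct
  -- locations.
  rw [Finset.sum_comm, ← Finset.sum_erase (Finset.univ) (a := x)]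
  · refine Finset.sum_congr rfl fun y hy => ?_
    have hxy : x ≠ y := (Finset.mem_erase.1 hy).1.symm
    rw [sum_trace_edgeDeriv_mul_edgeDeriv_mul (hmem x)]
    congr 2
    · by_cases h : l.path[y] = l.path[x]
      · rw [if_pos h, dif_pos ⟨hxy, h⟩]
        simp only [Loop.negTwist, Loop.posSplit₁, Loop.posSplit₂, wilson_coreLoop, pathTrace_eq,
          holonomy_append, holonomy_cons, holonomy_pathInv, holonomy_nil, mul_one]
      · rw [if_neg h, dif_neg fun h' => h h'.2]
    · by_cases h : l.path[y] = l.path[x]⁻¹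
      · rw [if_pos h, dif_pos ⟨hxy, h⟩]
        simp only [Loop.posTwist, Loop.negSplit₁, Loop.negSplit₂, wilson_coreLoop, pathTrace_eq,
          holonomy_append, holonomy_cons, holonomy_pathInv]
      · rw [if_neg h, dif_neg fun h' => h h'.2]
  · rw [dif_neg fun h => h.1 rfl, dif_neg fun h => h.1 rfl, add_zero, mul_zero]

open scoped Classical in
-- Serves mergers (`ρ'` a loop) and deformations (`ρ'` a plaquette) alike. It suffices that `ρ` lies
-- in `Λ`, since only pairs of parallel edges contribute.
theorem sum_traceDeriv_mul_traceDeriv (ρ ρ' : List (Edge d)) (hρ : IsClosed (ρ : Cycle (Edge d)))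
    (hρ' : IsClosed (ρ' : Cycle (Edge d))) (hin : ∀ f ∈ ρ, InLattice Λ f) (Q : Config Λ N) :
    ∑ D : Direction Λ N, traceDeriv D ρ Q * traceDeriv D ρ' Q =
      2 * ∑ x, ∑ y, if h : Parallel ρ ρ' x y then
        wilson Q (negMerge ρ ρ' hρ hρ' x y h) - wilson Q (posMerge ρ ρ' hρ hρ' x y h) else 0 := by
  simp only [traceDeriv, Finset.sum_mul_sum]
  rw [Finset.sum_comm, Finset.mul_sum]
  refine Finset.sum_congr rfl fun x _ => ?_
  rw [Finset.sum_comm, Finset.mul_sum]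
  refine Finset.sum_congr rfl fun y _ => ?_
  rw [sum_trace_edgeDeriv_mul_trace (f := ρ[x]) (hin _ (List.getElem_mem _))]
  congr 1
  by_cases h : ρ'[y] = ρ[x]
  · have h' : ρ'[y] ≠ ρ[x]⁻¹ := fun h' => Edge.inv_ne _ (h'.symm.trans h)
    have hp : Parallel ρ ρ' x y := Or.inl h
    rw [if_pos h, if_neg h', dif_pos hp, add_zero]
    simp only [negMerge, posMerge, if_pos h, wilson_coreLoop, pathTrace_eq, holonomy_append,
      holonomy_cons, holonomy_pathInv]
  · rw [if_neg h, zero_add]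
    by_cases h' : ρ'[y] = ρ[x]⁻¹
    · have hp : Parallel ρ ρ' x y := Or.inr h'
      rw [if_pos h', dif_pos hp]
      simp only [negMerge, posMerge, if_neg h, wilson_coreLoop, pathTrace_eq, holonomy_append,
        holonomy_cons, holonomy_pathInv]
    · have hp : ¬ Parallel ρ ρ' x y := not_or.2 ⟨h, h'⟩
      rw [if_neg h', dif_neg hp]

/-! ### Expectations -/

theorem continuous_pathTrace (ρ : List (Edge d)) :
    Continuous fun Q : Config Λ N => pathTrace Q ρ := by
  refine Continuous.matrix_trace (continuous_subtype_val.comp ?_)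
  exact continuous_list_prod _ fun e _ => continuous_at e

theorem continuous_wilson (l : Loop d) : Continuous fun Q : Config Λ N => wilson Q l := by
  simpa only [wilson_eq_pathTrace] using continuous_pathTrace l.path

theorem continuous_gaugeWeight (β : ℝ) : Continuous (gaugeWeight Λ N β) :=
  (continuous_const.mul (continuous_finsetSum _ fun p _ => continuous_pathTrace p)).rexp

/-- Nonnegativity of the density makes `ENNReal.ofReal` exact. The master loop equation is linear in
expectations, so the value of the normalizing constant plays no further role. -/
theorem integral_gaugeMeasure (β : ℝ) (F : Config Λ N → ℝ) :
    ∫ Q, F Q ∂gaugeMeasure Λ N β =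
      (partitionFunction Λ N β)⁻¹ * ∫ Q, F Q * gaugeWeight Λ N β Q ∂haarConfig Λ N := by
  have hZ : 0 ≤ (partitionFunction Λ N β)⁻¹ :=
    inv_nonneg.2 (integral_nonneg fun Q => (Real.exp_pos _).le)
  rw [gaugeMeasure, integral_withDensity_eq_integral_toReal_smul _
    (Filter.Eventually.of_forall fun _ => ENNReal.ofReal_lt_top), ← integral_const_mul]
  · refine integral_congr_ae (Filter.Eventually.of_forall fun Q => ?_)
    have hw : 0 ≤ gaugeWeight Λ N β Q := Real.exp_nonneg _
    simp only [smul_eq_mul]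
    rw [ENNReal.toReal_ofReal (mul_nonneg hZ hw)]
    ring
  · exact (continuous_const.mul (continuous_gaugeWeight β)).measurable.ennreal_ofReal

instance (β : ℝ) : IsFiniteMeasure (gaugeMeasure Λ N β) :=
  isFiniteMeasure_withDensity_ofReal
    (integrable_of_continuous (continuous_const.mul (continuous_gaugeWeight β))).2

/-- The expectation of continuous functions under the gauge measure. -/
noncomputable def expectation (Λ : Finset (Fin d → ℤ)) (N : ℕ) (β : ℝ) :
    C(Config Λ N, ℝ) →ₗ[ℝ] ℝ where
  toFun F := ∫ Q, F Q ∂gaugeMeasure Λ N β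
  map_add' F G := integral_add (integrable_of_continuous F.continuous)
    (integrable_of_continuous G.continuous)
  map_smul' c _ := integral_const_mul c _

/-- The normalized Wilson loop variable `W_l / N`. -/
noncomputable def normalizedWilson (Q : Config Λ N) (l : Loop d) : ℝ := wilson Q l / N

/-- The random variable whose expectation is `phi Λ N β s`. -/
noncomputable def observable (Λ : Finset (Fin d → ℤ)) (N : ℕ) (s : LoopSeq d) :
    C(Config Λ N, ℝ) where
  toFun Q := (s.minRep.map (normalizedWilson Q)).prod
  continuous_toFun := continuous_list_prod _ fun l _ => (continuous_wilson l).div_const _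

theorem expectation_observable (β : ℝ) (s : LoopSeq d) :
    expectation Λ N β (observable Λ N s) = phi Λ N β s := by
  have h : ∀ (Q : Config Λ N) (L : List (Loop d)), (L.map (normalizedWilson Q)).prod =
      (L.map (wilson Q)).prod / (N : ℝ) ^ L.length := fun Q L => by
    induction L with
    | nil => simp
    | cons l L ih => simp [ih, normalizedWilson, pow_succ', div_mul_div_comm]
  change ∫ Q, (s.minRep.map (normalizedWilson Q)).prod ∂gaugeMeasure Λ N β = _
  simp only [h, phi, integral_div]

/-- A null loop has variable `Tr 1 = N`, so its normalized factor is `1` and any representative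
gives the same product. -/
theorem observable_mk (hN : N ≠ 0) (L : List (Loop d)) (Q : Config Λ N) :
    observable Λ N (LoopSeq.mk L) Q = (L.map (normalizedWilson Q)).prod := by
  change ((dropNull L).map (normalizedWilson Q)).prod = _
  induction L with
  | nil => rfl
  | cons l L ih =>
    by_cases h : l = Loop.null d
    · have : normalizedWilson Q (Loop.null d) = 1 := by
        rw [normalizedWilson, wilson_null, div_self (Nat.cast_ne_zero.2 hN)]
      rw [dropNull, List.filter_cons_of_neg (by simpa using h), ← dropNull, ih, h, List.map_cons,
        List.prod_cons, this, one_mul]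
    · rw [dropNull, List.filter_cons_of_pos (by simpa using h), ← dropNull, List.map_cons,
        List.prod_cons, ih, List.map_cons, List.prod_cons]

theorem sum_map_observable_apply (m : Multiset (LoopSeq d)) (Q : Config Λ N) :
    (m.map (observable Λ N)).sum Q = (m.map fun s => observable Λ N s Q).sum := by
  induction m using Multiset.induction with
  | empty => simp
  | cons s m ih => simp [ih]

theorem expectation_sum_map_observable (β : ℝ) (m : Multiset (LoopSeq d)) :
    expectation Λ N β (m.map (observable Λ N)).sum = (m.map (phi Λ N β)).sum := by
  induction m using Multiset.induction with
  | empty => simp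
  | cons s m ih => simp [ih, expectation_observable]

/-! ### Products over the components of a loop sequence -/

/-- A product over all of `Fin n` can be peeled with `Fin.prod_univ_succ`, which the inductions on
lists below require. -/
theorem prod_erase_eq_prod_ite {n : ℕ} (f : Fin n → ℝ) (k : Fin n) :
    ∏ j ∈ Finset.univ.erase k, f j = ∏ j, if j = k then 1 else f j := by
  rw [← Finset.filter_ne', Finset.prod_filter]
  exact Finset.prod_congr rfl fun j _ => by by_cases h : j = k <;> simp [h]

theorem prod_erase_erase_eq_prod_ite {n : ℕ} (f : Fin n → ℝ) (k r : Fin n) :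
    ∏ j ∈ (Finset.univ.erase k).erase r, f j =
      ∏ j, if j = k then 1 else if j = r then 1 else f j := by
  rw [← prod_erase_eq_prod_ite, ← Finset.filter_ne', Finset.prod_filter]
  exact Finset.prod_congr rfl fun j _ => by by_cases h : j = r <;> simp [h]

theorem prod_map_take_mul_drop {α : Type*} (f : α → ℝ) (L : List α) (k : Fin L.length) :
    ((L.take k).map f).prod * ((L.drop (k + 1)).map f).prod =
      ∏ j ∈ Finset.univ.erase k, f L[j] := by
  rw [prod_erase_eq_prod_ite]
  induction L with
  | nil => exact k.elim0
  | cons a L ih =>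
    refine Fin.cases ?_ (fun k => ?_) k
    · simp [Fin.prod_univ_succ, ← Fin.prod_univ_fun_getElem]
    · have := ih k
      simp only [Fin.getElem_fin] at this
      simp [Fin.prod_univ_succ, ← this, mul_assoc, (Fin.succ_ne_zero _).symm, -List.map_take,
        -List.map_drop]

theorem prod_map_set {α : Type*} (f : α → ℝ) (L : List α) (k : Fin L.length) (a : α) :
    ((L.set k a).map f).prod = f a * ∏ j ∈ Finset.univ.erase k, f L[j] := by
  rw [← prod_map_take_mul_drop, List.set_eq_take_append_cons_drop, if_pos k.2]
  simp
  ring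

theorem prod_map_eraseIdx {α : Type*} (f : α → ℝ) (L : List α) (k : Fin L.length) :
    ((L.eraseIdx k).map f).prod = ∏ j ∈ Finset.univ.erase k, f L[j] := by
  rw [← prod_map_take_mul_drop, List.eraseIdx_eq_take_drop_succ]
  simp

theorem prod_map_set_eraseIdx {α : Type*} (f : α → ℝ) (L : List α) (k r : Fin L.length)
    (h : k ≠ r) (a : α) : (((L.set k a).eraseIdx r).map f).prod =
      f a * ∏ j ∈ (Finset.univ.erase k).erase r, f L[j] := by
  induction L with
  | nil => exact k.elim0
  | cons b L ih =>
    induction k using Fin.cases with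
    | zero =>
      induction r using Fin.cases with
      | zero => exact absurd rfl h
      | succ r =>
        have := prod_map_eraseIdx f L r
        rw [prod_erase_eq_prod_ite] at this
        rw [prod_erase_erase_eq_prod_ite]
        simp only [Fin.getElem_fin] at this
        simp [Fin.prod_univ_succ, this, -List.map_set]
    | succ k =>
      induction r using Fin.cases with
      | zero =>
        have := prod_map_set f L k a
        rw [prod_erase_eq_prod_ite] at this
        rw [prod_erase_erase_eq_prod_ite]
        simp only [Fin.getElem_fin] at this
        simp [Fin.prod_univ_succ, this, (Fin.succ_ne_zero _).symm, -List.map_set]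
      | succ r =>
        have := ih k r (fun h' => h (by rw [h']))
        rw [prod_erase_erase_eq_prod_ite] at this ⊢
        simp only [Fin.getElem_fin] at this
        simp [Fin.prod_univ_succ, this, (Fin.succ_ne_zero _).symm, -List.map_set]
        ring

/-! ### Plaquettes and locality -/

/-- All points at lattice distance at most one from the end points of `f` belong to `Λ`. -/
def NeighborhoodIn (Λ : Finset (Fin d → ℤ)) (f : Edge d) : Prop :=
  ∀ v, v = f.src ∨ v = f.tgt → ∀ w : Fin d → ℤ, ∑ i, |w i - v i| ≤ 1 → w ∈ Λ

theorem NeighborhoodIn.inLattice {f : Edge d} (h : NeighborhoodIn Λ f) : InLattice Λ f :=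
  ⟨h _ (Or.inl rfl) _ (by simp), h _ (Or.inr rfl) _ (by simp)⟩

theorem NeighborhoodIn.inv {f : Edge d} (h : NeighborhoodIn Λ f) : NeighborhoodIn Λ f⁻¹ :=
  fun v hv => h v hv.symm

theorem NeighborhoodIn.tgt_mem {f g : Edge d} (h : NeighborhoodIn Λ f) (hg : g.src = f.tgt) :
    g.tgt ∈ Λ := h _ (Or.inr rfl) _ (by rw [← hg, g.adj])

theorem NeighborhoodIn.src_mem {f g : Edge d} (h : NeighborhoodIn Λ f) (hg : g.tgt = f.src) :
    g.src ∈ Λ := h _ (Or.inl rfl) _ (by rw [← hg]; exact g⁻¹.adj.le)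

/-- The two vertices off `f₁` are each adjacent to one of its end points. -/
theorem inLattice_of_closed_four {f₁ f₂ f₃ f₄ : Edge d} (h : NeighborhoodIn Λ f₁)
    (h₁₂ : f₂.src = f₁.tgt) (h₂₃ : f₃.src = f₂.tgt) (h₃₄ : f₄.src = f₃.tgt)
    (h₄₁ : f₄.tgt = f₁.src) :
    InLattice Λ f₁ ∧ InLattice Λ f₂ ∧ InLattice Λ f₃ ∧ InLattice Λ f₄ := by
  have hs := h.inLattice
  have h₂ := h.tgt_mem h₁₂
  have h₄ := h.src_mem h₄₁
  exact ⟨hs, ⟨h₁₂ ▸ hs.2, h₂⟩, ⟨h₂₃ ▸ h₂, h₃₄ ▸ h₄⟩, h₄, h₄₁ ▸ hs.1⟩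

/-- This is where the margin of width one around the loops is needed: deformations use every
plaquette at an edge, whereas the action contains only the plaquettes inside `Λ`. -/
theorem posPlaquettesAt_subset {f : Edge d} (h : NeighborhoodIn Λ f) :
    posPlaquettesAt f ⊆ posPlaquettesIn Λ := by
  intro p hp
  obtain ⟨hp, hf⟩ := (finite_posPlaquettesAt f).mem_toFinset.1 hp
  refine (finite_posPlaquettesIn Λ).mem_toFinset.2 ⟨hp, ?_⟩
  obtain ⟨g, hg, hgp⟩ : ∃ g, NeighborhoodIn Λ g ∧ g ∈ p :=
    hf.elim (fun hf => ⟨f, h, hf⟩) fun hf => ⟨f⁻¹, h.inv, hf⟩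
  obtain ⟨⟨-, hc, -⟩, e₁, e₂, e₃, e₄, rfl, -⟩ := hp
  obtain ⟨h₁, h₂, h₃, h₄⟩ := isClosed_cons.1 hc
  have key : InLattice Λ e₁ ∧ InLattice Λ e₂ ∧ InLattice Λ e₃ ∧ InLattice Λ e₄ := by
    simp only [List.mem_cons, List.not_mem_nil, or_false] at hgp
    rcases hgp with rfl | rfl | rfl | rfl
    · exact inLattice_of_closed_four hg h₁ h₂ h₃ h₄
    -- The remaining cases rotate the plaquette cyclically so that the edge with the known
    -- neighbourhood comes first.
    · have := inLattice_of_closed_four hg h₂ h₃ h₄.symm h₁.symm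
      tauto
    · have := inLattice_of_closed_four hg h₃ h₄.symm h₁ h₂.symm
      tauto
    · have := inLattice_of_closed_four hg h₄.symm h₁ h₂ h₃.symm
      tauto
  simpa [InLattice] using key

theorem isClosed_of_mem_posPlaquettesIn {p : List (Edge d)} (h : p ∈ posPlaquettesIn Λ) :
    IsClosed (p : Cycle (Edge d)) :=
  ((finite_posPlaquettesIn Λ).mem_toFinset.1 h).1.1.2.1

theorem mem_posPlaquettesAt_of_parallel {ρ p : List (Edge d)} (hp : p ∈ posPlaquettesIn Λ)
    {x : Fin ρ.length} {y : Fin p.length} (h : Parallel ρ p x y) : p ∈ posPlaquettesAt ρ[x] :=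
  (finite_posPlaquettesAt _).mem_toFinset.2
    ⟨((finite_posPlaquettesIn Λ).mem_toFinset.1 hp).1,
      h.imp (fun h : p[y] = ρ[x] => h ▸ List.getElem_mem _)
        fun h : p[y] = ρ[x]⁻¹ => h ▸ List.getElem_mem _⟩

open scoped Classical in
theorem sum_traceDeriv_mul_plaquettes (ρ : List (Edge d)) (hρ : IsClosed (ρ : Cycle (Edge d)))
    (hin : ∀ f ∈ ρ, NeighborhoodIn Λ f) (Q : Config Λ N) :
    ∑ D : Direction Λ N, traceDeriv D ρ Q * ∑ p ∈ posPlaquettesIn Λ, traceDeriv D p Q =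
      2 * ∑ x : Fin ρ.length, ∑ p ∈ (posPlaquettesAt ρ[x]).attach, ∑ y,
        if h : Parallel ρ p.1 x y then
          wilson Q (negMerge ρ p.1 hρ (isClosed_of_mem_posPlaquettesAt p.2) x y h) -
          wilson Q (posMerge ρ p.1 hρ (isClosed_of_mem_posPlaquettesAt p.2) x y h) else 0 := by
  -- Mergers require a closed word. Extending by zero to all lists allows the sums over `𝒫⁺_Λ` and
  -- over `𝒫⁺(e)` to be compared.
  let H : Fin ρ.length → List (Edge d) → ℝ := fun x p =>
    if hc : IsClosed (p : Cycle (Edge d)) then ∑ y, if h : Parallel ρ p x y then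
      wilson Q (negMerge ρ p hρ hc x y h) - wilson Q (posMerge ρ p hρ hc x y h) else 0 else 0
  have h₁ : ∀ p ∈ posPlaquettesIn Λ, ∑ D : Direction Λ N, traceDeriv D ρ Q * traceDeriv D p Q =
      2 * ∑ x, H x p := fun p hp => by
    have hc := isClosed_of_mem_posPlaquettesIn hp
    rw [sum_traceDeriv_mul_traceDeriv ρ p hρ hc fun f hf => (hin f hf).inLattice]
    simp only [H, dif_pos hc]
  simp only [Finset.mul_sum]
  rw [Finset.sum_comm, Finset.sum_congr rfl h₁, ← Finset.mul_sum, Finset.sum_comm, Finset.mul_sum]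
  refine Finset.sum_congr rfl fun x _ => ?_
  -- Plaquettes of the action that avoid the edge at `x` have no parallel location and contribute
  -- zero.
  rw [← Finset.sum_subset (posPlaquettesAt_subset (hin ρ[x] (List.getElem_mem _))),
    ← Finset.sum_attach, Finset.mul_sum]
  · refine Finset.sum_congr rfl fun p _ => ?_
    simp only [H, dif_pos (isClosed_of_mem_posPlaquettesAt p.2), Finset.mul_sum]
  · intro p hp hp'
    simp only [H, dif_pos (isClosed_of_mem_posPlaquettesIn hp)]
    exact Finset.sum_eq_zero fun y _ =>
      dif_neg fun h => hp' (mem_posPlaquettesAt_of_parallel hp h)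

/-! ### Observables of the results of the operations on loop sequences -/

theorem observable_eq_prod (s : LoopSeq d) (Q : Config Λ N) :
    observable Λ N s Q = ∏ k : Fin s.minRep.length, normalizedWilson Q s.minRep[k] :=
  (Fin.prod_univ_fun_getElem s.minRep (normalizedWilson Q)).symm

theorem observable_replace (hN : N ≠ 0) (s : LoopSeq d) (k : Fin s.minRep.length)
    (L : List (Loop d)) (Q : Config Λ N) : observable Λ N (s.replace k L) Q =
      (L.map (normalizedWilson Q)).prod *
        ∏ j ∈ Finset.univ.erase k, normalizedWilson Q s.minRep[j] := by
  rw [LoopSeq.replace, observable_mk hN, ← prod_map_take_mul_drop]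
  simp only [List.map_append, List.prod_append]
  ring

theorem observable_replaceRemove (hN : N ≠ 0) (s : LoopSeq d) (k r : Fin s.minRep.length)
    (h : k ≠ r) (l : Loop d) (Q : Config Λ N) : observable Λ N (s.replaceRemove k r l) Q =
      normalizedWilson Q l *
        ∏ j ∈ (Finset.univ.erase k).erase r, normalizedWilson Q s.minRep[j] := by
  rw [LoopSeq.replaceRemove, observable_mk hN, prod_map_set_eraseIdx _ _ _ _ h]

theorem sum_map_finsetSum {ι α : Type*} (F : α → ℝ) (t : Finset ι) (m : ι → Multiset α) :
    ((∑ i ∈ t, m i).map F).sum = ∑ i ∈ t, ((m i).map F).sum :=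
  map_sum (Multiset.sumAddMonoidHom.comp (Multiset.mapAddMonoidHom F)) m t

theorem sum_map_dite {α : Type*} (F : α → ℝ) (p : Prop) [Decidable p] (a : p → α) :
    ((if h : p then ({a h} : Multiset α) else 0).map F).sum = if h : p then F (a h) else 0 := by
  split_ifs <;> simp

theorem dite_sub_dite_zero (p : Prop) [Decidable p] (a b : p → ℝ) :
    (if h : p then a h - b h else 0) = (if h : p then a h else 0) - if h : p then b h else 0 := by
  split_ifs <;> simp

theorem mul_dite_zero_right (c : ℝ) (p : Prop) [Decidable p] (a : p → ℝ) :
    c * (if h : p then a h else 0) = if h : p then c * a h else 0 := by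
  split_ifs <;> simp

open scoped Classical in
-- A splitting puts two loop variables over a single `1 / N`, so expressing it by normalized
-- variables costs a factor `N`. A twisting keeps the count.
theorem sum_traceDerivTwo_component (hN : N ≠ 0) (s : LoopSeq d) (k : Fin s.minRep.length)
    (hk : ∀ f ∈ s.minRep[k].path, InLattice Λ f) (Q : Config Λ N) :
    (∑ D : Direction Λ N, traceDerivTwo D s.minRep[k].path Q) / N *
      ∏ j ∈ Finset.univ.erase k, normalizedWilson Q s.minRep[j] =
    2 * (-(((N : ℝ) - 1) * s.minRep[k].length * observable Λ N s Q) +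
      ∑ x, ∑ y,
        ((if h : SameAt s.minRep[k].path x y then
            observable Λ N (s.replace k [s.minRep[k].negTwist x y h]) Q -
            N * observable Λ N
              (s.replace k [s.minRep[k].posSplit₁ x y h, s.minRep[k].posSplit₂ x y h]) Q else 0) +
          if h : InvAt s.minRep[k].path x y then
            N * observable Λ N
              (s.replace k [s.minRep[k].negSplit₁ x y h, s.minRep[k].negSplit₂ x y h]) Q -
            observable Λ N (s.replace k [s.minRep[k].posTwist x y h]) Q else 0)) := by
  have hN' : (N : ℝ) ≠ 0 := Nat.cast_ne_zero.2 hN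
  rw [sum_traceDerivTwo_path _ hk, observable_eq_prod, ← Finset.mul_prod_erase _ _ (Finset.mem_univ k),
    mul_div_assoc, mul_assoc, add_div, add_mul]
  congr 2
  · rw [normalizedWilson]
    ring
  simp only [Finset.sum_div, Finset.sum_mul]
  refine Finset.sum_congr rfl fun x _ => Finset.sum_congr rfl fun y _ => ?_
  rw [add_div, add_mul]
  congr 1
  · split_ifs with h
    · simp only [observable_replace hN, List.map_cons, List.map_nil, List.prod_cons, List.prod_nil,
        normalizedWilson]
      field_simp
    · simp
  · split_ifs with h
    · simp only [observable_replace hN, List.map_cons, List.map_nil, List.prod_cons, List.prod_nil,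
        normalizedWilson]
      field_simp
    · simp

open scoped Classical in
-- A merger leaves one loop variable over `N²`, hence the factor `1 / N`.
theorem sum_traceDeriv_mul_component (hN : N ≠ 0) (s : LoopSeq d) (k r : Fin s.minRep.length)
    (hkr : k ≠ r) (hk : ∀ f ∈ s.minRep[k].path, InLattice Λ f) (Q : Config Λ N) :
    (∑ D : Direction Λ N, traceDeriv D s.minRep[k].path Q / N *
      (traceDeriv D s.minRep[r].path Q / N)) *
      ∏ j ∈ (Finset.univ.erase k).erase r, normalizedWilson Q s.minRep[j] =
    2 * (1 / N * ∑ x, ∑ y, if h : k ≠ r ∧ Parallel s.minRep[k].path s.minRep[r].path x y then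
        observable Λ N (s.replaceRemove k r (negMerge s.minRep[k].path s.minRep[r].path
          s.minRep[k].isClosed_path s.minRep[r].isClosed_path x y h.2)) Q -
        observable Λ N (s.replaceRemove k r (posMerge s.minRep[k].path s.minRep[r].path
          s.minRep[k].isClosed_path s.minRep[r].isClosed_path x y h.2)) Q else 0) := by
  have hN' : (N : ℝ) ≠ 0 := Nat.cast_ne_zero.2 hN
  simp only [div_mul_div_comm]
  rw [← Finset.sum_div, sum_traceDeriv_mul_traceDeriv _ _ s.minRep[k].isClosed_path
    s.minRep[r].isClosed_path hk, mul_div_assoc, mul_assoc]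
  congr 1
  simp only [Finset.sum_div, Finset.sum_mul, Finset.mul_sum]
  refine Finset.sum_congr rfl fun x _ => Finset.sum_congr rfl fun y _ => ?_
  by_cases h : Parallel s.minRep[k].path s.minRep[r].path x y
  · rw [dif_pos h, dif_pos ⟨hkr, h⟩, observable_replaceRemove hN _ _ _ hkr,
      observable_replaceRemove hN _ _ _ hkr]
    simp only [normalizedWilson]
    field_simp
  · rw [dif_neg h, dif_neg fun h' => h h'.2]
    simp

open scoped Classical in
-- The plaquette traces in the action are not normalized, so merging with one of them changes no
-- power of `N`, and the coefficient `N β` of the action survives unchanged.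
theorem sum_traceDeriv_mul_plaquettes_component (hN : N ≠ 0) (s : LoopSeq d)
    (k : Fin s.minRep.length) (hk : ∀ f ∈ s.minRep[k].path, NeighborhoodIn Λ f) (Q : Config Λ N) :
    (∑ D : Direction Λ N, traceDeriv D s.minRep[k].path Q / N *
      ∑ p ∈ posPlaquettesIn Λ, traceDeriv D p Q) *
      ∏ j ∈ Finset.univ.erase k, normalizedWilson Q s.minRep[j] =
    2 * ∑ x : Fin s.minRep[k].path.length, ∑ p ∈ (posPlaquettesAt s.minRep[k].path[x]).attach, ∑ y,
      if h : Parallel s.minRep[k].path p.1 x y then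
        observable Λ N (s.replace k [negMerge s.minRep[k].path p.1 s.minRep[k].isClosed_path
          (isClosed_of_mem_posPlaquettesAt p.2) x y h]) Q -
        observable Λ N (s.replace k [posMerge s.minRep[k].path p.1 s.minRep[k].isClosed_path
          (isClosed_of_mem_posPlaquettesAt p.2) x y h]) Q else 0 := by
  simp only [div_mul_eq_mul_div]
  rw [← Finset.sum_div, sum_traceDeriv_mul_plaquettes _ s.minRep[k].isClosed_path hk,
    mul_div_assoc, mul_assoc]
  congr 1
  simp only [Finset.sum_div, Finset.sum_mul]
  refine Finset.sum_congr rfl fun x _ => Finset.sum_congr rfl fun p _ =>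
    Finset.sum_congr rfl fun y _ => ?_
  split_ifs with h
  · simp only [observable_replace hN, List.map_cons, List.map_nil, List.prod_cons, List.prod_nil,
      normalizedWilson]
    ring
  · simp

/-! ### The master loop equation -/

/-- The generator of the Langevin dynamics (a Laplacian with drift) in the direction `D`, applied
to the observable of `s`. -/
noncomputable def generator (β : ℝ) (s : LoopSeq d) (D : Direction Λ N) (Q : Config Λ N) : ℝ :=
  ∑ k : Fin s.minRep.length,
    (traceDerivTwo D s.minRep[k].path Q / N *
        ∏ j ∈ Finset.univ.erase k, normalizedWilson Q s.minRep[j] +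
      traceDeriv D s.minRep[k].path Q / N *
        ∑ r ∈ Finset.univ.erase k, traceDeriv D s.minRep[r].path Q / N *
          ∏ j ∈ (Finset.univ.erase k).erase r, normalizedWilson Q s.minRep[j]) +
  (∑ k : Fin s.minRep.length, traceDeriv D s.minRep[k].path Q / N *
      ∏ j ∈ Finset.univ.erase k, normalizedWilson Q s.minRep[j]) *
    (N * β * ∑ p ∈ posPlaquettesIn Λ, traceDeriv D p Q)

theorem hasLieDeriv_normalizedWilson (D : Direction Λ N) (l : Loop d) :
    HasLieDeriv D (fun Q => normalizedWilson Q l) (fun Q => traceDeriv D l.path Q / N) := by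
  simpa only [normalizedWilson, wilson_eq_pathTrace, div_eq_inv_mul] using
    (hasLieDeriv_pathTrace D l.path).const_mul (N : ℝ)⁻¹

theorem hasLieDeriv_gaugeWeight (D : Direction Λ N) (β : ℝ) :
    HasLieDeriv D (gaugeWeight Λ N β) (fun Q => gaugeWeight Λ N β Q *
      (N * β * ∑ p ∈ posPlaquettesIn Λ, traceDeriv D p Q)) :=
  ((HasLieDeriv.sum fun p _ => hasLieDeriv_pathTrace D p).const_mul (N * β)).exp

/-- The function differentiated is `(D F) · w`, with `F` the observable of `s` and `w` the gauge
weight. Its derivative has `w` as a factor, so the vanishing Haar integral becomes a vanishing gauge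
expectation. -/
theorem hasLieDeriv_generator (β : ℝ) (s : LoopSeq d) (D : Direction Λ N) :
    HasLieDeriv D
      (fun Q => (∑ k : Fin s.minRep.length, traceDeriv D s.minRep[k].path Q / N *
        ∏ j ∈ Finset.univ.erase k, normalizedWilson Q s.minRep[j]) * gaugeWeight Λ N β Q)
      (fun Q => generator β s D Q * gaugeWeight Λ N β Q) := by
  have h := (HasLieDeriv.sum (s := Finset.univ) fun (k : Fin s.minRep.length) _ =>
    ((hasLieDeriv_traceDeriv D s.minRep[k].path).const_mul (N : ℝ)⁻¹).mul
      (HasLieDeriv.prod (s := Finset.univ.erase k) fun j _ =>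
        hasLieDeriv_normalizedWilson D s.minRep[j])).mul (hasLieDeriv_gaugeWeight D β)
  simp only [← div_eq_inv_mul] at h
  refine h.congr_deriv fun Q => ?_
  rw [generator]
  ring

theorem continuous_generator (β : ℝ) (s : LoopSeq d) (D : Direction Λ N) :
    Continuous (generator β s D) := by
  have h := (hasLieDeriv_generator β s D).continuous_deriv
  have hg : ∀ Q, gaugeWeight Λ N β Q ≠ 0 := fun Q => Real.exp_ne_zero _
  -- The product of generator and weight is continuous, being a Lie derivative, and the weight never
  -- vanishes.
  simpa [hg] using h.div₀ (continuous_gaugeWeight β) hg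

theorem expectation_generator (β : ℝ) (s : LoopSeq d) (D : Direction Λ N) :
    expectation Λ N β ⟨generator β s D, continuous_generator β s D⟩ = 0 := by
  change ∫ Q, generator β s D Q ∂gaugeMeasure Λ N β = 0
  rw [integral_gaugeMeasure, (hasLieDeriv_generator β s D).integral_eq_zero, mul_zero]

theorem LoopSeq.length_eq_sum (s : LoopSeq d) :
    s.length = ∑ k : Fin s.minRep.length, s.minRep[k].length :=
  (Fin.sum_univ_fun_getElem s.minRep Loop.length).symm

theorem sum_generator (hN : N ≠ 0) (β : ℝ) (s : LoopSeq d)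
    (hs : ∀ l ∈ s.minRep, ∀ f ∈ l.path, NeighborhoodIn Λ f) (Q : Config Λ N) :
    ∑ D : Direction Λ N, generator β s D Q =
      2 * (-(((N : ℝ) - 1) * s.length * observable Λ N s Q) +
        ((s.negTwistings.map fun s => observable Λ N s Q).sum
        - (s.posTwistings.map fun s => observable Λ N s Q).sum
        + N * (s.negSplittings.map fun s => observable Λ N s Q).sum
        - N * (s.posSplittings.map fun s => observable Λ N s Q).sum
        + 1 / N * (s.negMergers.map fun s => observable Λ N s Q).sum
        - 1 / N * (s.posMergers.map fun s => observable Λ N s Q).sum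
        + N * β * (s.negDeformations.map fun s => observable Λ N s Q).sum
        - N * β * (s.posDeformations.map fun s => observable Λ N s Q).sum)) := by
  classical
  have hk : ∀ k : Fin s.minRep.length, ∀ f ∈ s.minRep[k].path, NeighborhoodIn Λ f :=
    fun k => hs _ (List.getElem_mem _)
  have hk' : ∀ k : Fin s.minRep.length, ∀ f ∈ s.minRep[k].path, InLattice Λ f :=
    fun k f hf => (hk k f hf).inLattice
  have e₁ : ∑ D : Direction Λ N, generator β s D Q = ∑ k : Fin s.minRep.length,
      ((∑ D : Direction Λ N, traceDerivTwo D s.minRep[k].path Q) / N *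
        ∏ j ∈ Finset.univ.erase k, normalizedWilson Q s.minRep[j] +
      ∑ r ∈ Finset.univ.erase k, (∑ D : Direction Λ N, traceDeriv D s.minRep[k].path Q / N *
        (traceDeriv D s.minRep[r].path Q / N)) *
          ∏ j ∈ (Finset.univ.erase k).erase r, normalizedWilson Q s.minRep[j] +
      N * β * ((∑ D : Direction Λ N, traceDeriv D s.minRep[k].path Q / N *
        ∑ p ∈ posPlaquettesIn Λ, traceDeriv D p Q) *
          ∏ j ∈ Finset.univ.erase k, normalizedWilson Q s.minRep[j])) := by
    simp only [generator, Finset.sum_add_distrib]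
    congr 1
    · congr 1
      · rw [Finset.sum_comm]
        simp only [Finset.sum_div, Finset.sum_mul]
      · rw [Finset.sum_comm]
        refine Finset.sum_congr rfl fun k _ => ?_
        simp only [Finset.mul_sum, Finset.sum_mul]
        rw [Finset.sum_comm]
        simp only [mul_assoc]
    · simp only [Finset.sum_mul (s := (Finset.univ : Finset (Fin s.minRep.length)))]
      rw [Finset.sum_comm]
      refine Finset.sum_congr rfl fun k _ => ?_
      rw [Finset.sum_mul, Finset.mul_sum]
      exact Finset.sum_congr rfl fun D _ => by ring
  -- The condition `k ≠ r` is carried inside the summand, so that `r` may range over all components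
  -- as in the definition of the mergers.
  have e₂ : ∀ k : Fin s.minRep.length, ∑ r ∈ Finset.univ.erase k,
      (∑ D : Direction Λ N, traceDeriv D s.minRep[k].path Q / N *
        (traceDeriv D s.minRep[r].path Q / N)) *
          ∏ j ∈ (Finset.univ.erase k).erase r, normalizedWilson Q s.minRep[j] =
      2 * (1 / N * ∑ r, ∑ x, ∑ y,
        if h : k ≠ r ∧ Parallel s.minRep[k].path s.minRep[r].path x y then
        observable Λ N (s.replaceRemove k r (negMerge s.minRep[k].path s.minRep[r].path
          s.minRep[k].isClosed_path s.minRep[r].isClosed_path x y h.2)) Q -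
        observable Λ N (s.replaceRemove k r (posMerge s.minRep[k].path s.minRep[r].path
          s.minRep[k].isClosed_path s.minRep[r].isClosed_path x y h.2)) Q else 0) := fun k => by
    rw [Finset.sum_congr rfl fun r hr => sum_traceDeriv_mul_component hN s k r
      (Finset.mem_erase.1 hr).1.symm (hk' k) Q, Finset.sum_erase, Finset.mul_sum, Finset.mul_sum]
    simp
  rw [e₁]
  simp only [e₂, sum_traceDerivTwo_component hN s _ (hk' _),
    sum_traceDeriv_mul_plaquettes_component hN s _ (hk _)]
  simp only [LoopSeq.negTwistings, LoopSeq.posTwistings, LoopSeq.negSplittings,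
    LoopSeq.posSplittings, LoopSeq.negMergers, LoopSeq.posMergers, LoopSeq.negDeformations,
    LoopSeq.posDeformations, sum_map_finsetSum, sum_map_dite, s.length_eq_sum, dite_sub_dite_zero,
    ← mul_dite_zero_right, Finset.sum_add_distrib, Finset.sum_sub_distrib, ← Finset.mul_sum,
    Nat.cast_sum, Finset.sum_neg_distrib, ← Finset.sum_mul]
  ring

theorem master_loop_equation (hN : N ≠ 0) (β : ℝ) (s : LoopSeq d)
    (hs : ∀ l ∈ s.minRep, ∀ f ∈ l.path, NeighborhoodIn Λ f) :
    ((N : ℝ) - 1) * (s.length : ℝ) * phi Λ N β s =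
      (s.negTwistings.map (phi Λ N β)).sum - (s.posTwistings.map (phi Λ N β)).sum
      + N * (s.negSplittings.map (phi Λ N β)).sum - N * (s.posSplittings.map (phi Λ N β)).sum
      + 1 / N * (s.negMergers.map (phi Λ N β)).sum - 1 / N * (s.posMergers.map (phi Λ N β)).sum
      + N * β * (s.negDeformations.map (phi Λ N β)).sum
      - N * β * (s.posDeformations.map (phi Λ N β)).sum := by
  have key : ∑ D : Direction Λ N,
      (⟨generator β s D, continuous_generator β s D⟩ : C(Config Λ N, ℝ)) =
      (2 : ℝ) • (-(((N : ℝ) - 1) * s.length) • observable Λ N s +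
        ((s.negTwistings.map (observable Λ N)).sum
        - (s.posTwistings.map (observable Λ N)).sum
        + (N : ℝ) • (s.negSplittings.map (observable Λ N)).sum
        - (N : ℝ) • (s.posSplittings.map (observable Λ N)).sum
        + (1 / N : ℝ) • (s.negMergers.map (observable Λ N)).sum
        - (1 / N : ℝ) • (s.posMergers.map (observable Λ N)).sum
        + (N * β) • (s.negDeformations.map (observable Λ N)).sum
        - (N * β) • (s.posDeformations.map (observable Λ N)).sum)) := by
    ext Q
    have := sum_generator hN β s hs Q
    simp only [one_div] at this
    simp [sum_map_observable_apply, this]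
    ring
  -- Each direction has expectation zero, so the left side vanishes. Linearity turns the right side
  -- into twice the difference of the two sides of the claim.
  have h := congrArg (expectation Λ N β) key
  simp only [map_sum, expectation_generator, Finset.sum_const_zero, map_smul, map_add, map_sub,
    expectation_sum_map_observable, expectation_observable, smul_eq_mul] at h
  linarith

end LatticeGauge

theorem mainTheorem2 (d : ℕ) (hd : 2 ≤ d) (Λ : Finset (Fin d → ℤ)) (hΛ : Λ.Nonempty)
    (N : ℕ) (hN : 2 ≤ N) (β : ℝ) (s : LatticeGauge.LoopSeq d) (hs : s ≠ LatticeGauge.LoopSeq.null d)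
    (hsΛ : ∀ l ∈ s.minRep, ∀ v ∈ l.vertices, ∀ w : Fin d → ℤ, ∑ i, |w i - v i| ≤ 1 → w ∈ Λ) :
    ((N : ℝ) - 1) * (s.length : ℝ) * LatticeGauge.phi Λ N β s =
      (s.negTwistings.map (LatticeGauge.phi Λ N β)).sum - (s.posTwistings.map (LatticeGauge.phi Λ N β)).sum
      + N * (s.negSplittings.map (LatticeGauge.phi Λ N β)).sum - N * (s.posSplittings.map (LatticeGauge.phi Λ N β)).sum
      + 1 / N * (s.negMergers.map (LatticeGauge.phi Λ N β)).sum - 1 / N * (s.posMergers.map (LatticeGauge.phi Λ N β)).sum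
      + N * β * (s.negDeformations.map (LatticeGauge.phi Λ N β)).sum
      - N * β * (s.posDeformations.map (LatticeGauge.phi Λ N β)).sum := by
  refine LatticeGauge.master_loop_equation (by omega) β s fun l hl f hf v hv =>
    hsΛ l hl v ⟨f, ?_, hv⟩
  rw [← l.coe_path]
  exact Cycle.mem_coe_iff.2 hf
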